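/- Consider a system of $k\ge 1$ identical unit-rate servers. Inelastic and elastic jobs arrive in independent Poisson processes of rates $\lambda_I,\lambda_E>0$ and have independent exponentially distributed sizes of rates $\mu_I,\mu_E>0$. An inelastic job can use at most one server at a time, an elastic job any number; allocations may be fractional. Assume that the load satisfies $\rho=\frac{\lambda_I}{k\mu_I}+\frac{\lambda_E}{k\mu_E}<1$. A (stationary, deterministic) allocation policy $\pi$ specifies, for every state $(i,j)$ with $i$ inelastic and $j$ elastic jobs present, how many servers are given to each job (the jobs of a class being identified by their order of arrival), with at most $1$ server per inelastic job and at most $k$ servers in total; servers may be left idle. Let $\pi_I(i,j)$ and $\pi_E(i,j)$ be the total numbers of servers given to inelastic and to elastic jobs. The numbers $(N_I,N_E)$ of inelastic and elastic jobs form a Markov chain with transitions $(i,j)\to(i+1,j)$, $(i,j+1)$, $(i-1,j)$, $(i,j-1)$ at rates $\lambda_I$, $\lambda_E$, $\mu_I\pi_I(i,j)$, $\mu_E\pi_E(i,j)$. When this chain has a stationary distribution, let $N^\pi=N_I+N_E$ be the number of jobs in system in steady state and $T^\pi$ the response time (time from arrival to completion) of a job that arrives to the system in steady state; a policy without stationary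 distribution is not considered a competitor. A policy is work-conserving if for all $(i,j)$: $\pi_I(i,j)+\pi_E(i,j)\ge\min(i,k)$, and $\pi_I(i,j)+\pi_E(i,j)=k$ whenever $j>0$. It serves inelastic jobs first-come-first-serve (FCFS) if, whenever it allocates $N$ servers to inelastic jobs, the $\lfloor N\rfloor$ earliest-arrived inelastic jobs get one server each, the next one gets the remaining fraction, and the others get nothing. Let $\mathcal P$ be the class of work-conserving policies that serve inelastic jobs FCFS. Then $\mathcal P$ contains a policy $\pi$ that minimizes both the mean number of jobs in system and the mean response time: its chain $(N_I,N_E)$ has a unique stationary distribution, $\mathbb E[N^\pi]<\infty$, $\mathbb E[T^\pi]<\infty$, and for every allocation policy $\pi'$ (work-conserving or not) and every stationary distribution of its chain, $$\mathbb E[N^\pi]\le\mathbb E[N^{\pi'}]\qquad\text{and}\qquad \mathbb E[T^\pi]\le\mathbb E[T^{\pi'}].$$ -/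

import Mathlib

open scoped NNReal ENNReal
open MeasureTheory ProbabilityTheory

noncomputable section

namespace ElasticQueue

/-! ## Continuous-time Markov chains with finitely many transitions out of each state

A chain on `S` is given by `t : S → List (ℝ≥0 × S)`: the list `t x` holds the transitions
out of `x`, each as a pair (rate, target). -/

section Chain

variable {S : Type}

/-- Total rate out of `x`. -/
def outRate (t : S → List (ℝ≥0 × S)) (x : S) : ℝ≥0 := ((t x).map Prod.fst).sum

open Classical in
/-- Rate of the transition from `x` to `y`. -/
def rate (t : S → List (ℝ≥0 × S)) (x y : S) : ℝ≥0 :=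
  ((t x).map fun w => if w.2 = y then w.1 else 0).sum

/-- `p` is a stationary distribution of the chain: the global balance equations `p Q = 0`
(flow into `y` equals flow out of `y`). -/
def IsStationary (t : S → List (ℝ≥0 × S)) (p : PMF S) : Prop :=
  ∀ y, ∑' x, p x * (rate t x y : ℝ≥0∞) = p y * (outRate t y : ℝ≥0∞)

variable [MeasurableSpace S]

/-- Law of the state entered when the chain leaves `x`: target `y` has probability
(rate to `y`) / (total rate). A state without outgoing rate is absorbing. -/
def jumpMeasure (t : S → List (ℝ≥0 × S)) (x : S) : Measure S :=
  if outRate t x = 0 then Measure.dirac x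
  else ((t x).map fun w => (w.1 / outRate t x) • Measure.dirac w.2).sum

theorem list_sum_dirac_univ (c : ℝ≥0) (l : List (ℝ≥0 × S)) :
    (l.map fun w => (w.1 / c) • Measure.dirac w.2).sum Set.univ
      = (((l.map Prod.fst).sum / c : ℝ≥0) : ℝ≥0∞) := by
  induction l with
  | nil => simp
  | cons w l ih =>
    simp only [List.map_cons, List.sum_cons, Measure.add_apply, ih, Measure.smul_apply,
      measure_univ, add_div, ENNReal.coe_add]
    simp [ENNReal.smul_def]

theorem jumpMeasure_univ (t : S → List (ℝ≥0 × S)) (x : S) :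
    jumpMeasure t x Set.univ = 1 := by
  unfold jumpMeasure
  split_ifs with h
  · simp
  · rw [list_sum_dirac_univ]
    have : (((t x).map Prod.fst).sum / outRate t x : ℝ≥0) = 1 := div_self h
    rw [this, ENNReal.coe_one]

variable [DiscreteMeasurableSpace S]

/-- The transition kernel of the embedded jump chain. -/
def jumpKernel (t : S → List (ℝ≥0 × S)) : Kernel S S :=
  ⟨jumpMeasure t, Measurable.of_discrete⟩

instance (t : S → List (ℝ≥0 × S)) : IsMarkovKernel (jumpKernel t) :=
  ⟨fun x => ⟨jumpMeasure_univ t x⟩⟩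

/-- The jump kernel as a function of the history up to the `n`-th jump. -/
def historyKernel (t : S → List (ℝ≥0 × S)) (n : ℕ) :
    Kernel ((i : Finset.Iic n) → (fun _ : ℕ => S) i) S :=
  (jumpKernel t).comap (fun h => h ⟨n, Finset.mem_Iic.2 le_rfl⟩) (measurable_pi_apply _)

instance (t : S → List (ℝ≥0 × S)) (n : ℕ) : IsMarkovKernel (historyKernel t n) := by
  unfold historyKernel; infer_instance

/-- Law of the embedded jump chain `Y₀, Y₁, Y₂, …` started at `Y₀ = x`. -/
def jumpChain (t : S → List (ℝ≥0 × S)) (x : S) : Measure (ℕ → S) :=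
  Kernel.traj (X := fun _ => S) (historyKernel t) 0 (fun _ => x)

/-- The probability space of the continuous-time chain started at `x`: the embedded jump chain
together with an independent sequence of i.i.d. exponential variables of rate `1`. -/
def chainMeasure (t : S → List (ℝ≥0 × S)) (x : S) : Measure ((ℕ → S) × (ℕ → ℝ)) :=
  (jumpChain t x).prod (Measure.infinitePi fun _ : ℕ => expMeasure 1)

/-- The time the chain spends in its `n`-th state: the `n`-th exponential variable divided by the
total rate out of that state. It is infinite (almost surely) in an absorbing state. -/
def holdingTime (t : S → List (ℝ≥0 × S)) (ω : (ℕ → S) × (ℕ → ℝ)) (n : ℕ) : ℝ≥0∞ :=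
  ENNReal.ofReal (ω.2 n) / (outRate t (ω.1 n) : ℝ≥0∞)

open Classical in
/-- The total time that the chain spends in `A`. -/
def timeIn (t : S → List (ℝ≥0 × S)) (A : Set S) (ω : (ℕ → S) × (ℕ → ℝ)) : ℝ≥0∞ :=
  ∑' n, if ω.1 n ∈ A then holdingTime t ω n else 0

end Chain

/-! ## The model -/

/-- The parameters: `k` identical servers; inelastic and elastic jobs arrive in independent
Poisson processes of rates `lamI`, `lamE` and have independent exponential sizes of
rates `muI`, `muE`. -/
structure System where
  k : ℕ
  lamI : ℝ≥0
  lamE : ℝ≥0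
  muI : ℝ≥0
  muE : ℝ≥0
  k_pos : 0 < k
  lamI_pos : 0 < lamI
  lamE_pos : 0 < lamE
  muI_pos : 0 < muI
  muE_pos : 0 < muE

/-- The system load `ρ`. -/
def System.load (M : System) : ℝ≥0 := M.lamI / (M.k * M.muI) + M.lamE / (M.k * M.muE)

/-- A stationary deterministic allocation policy. When `i` inelastic and `j` elastic jobs are
present, `inel i j r` (for `r < i`) is the number of servers given to the inelastic job with
exactly `r` inelastic jobs in the system that arrived before it, and `el i j r` (for `r < j`) is
the number of servers given to the elastic job with exactly `r` earlier elastic jobs in the system.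
Allocations may be fractional; servers may be left idle. -/
structure Policy (M : System) where
  inel : ℕ → ℕ → ℕ → ℝ≥0
  el : ℕ → ℕ → ℕ → ℝ≥0
  inel_le_one : ∀ i j r, r < i → inel i j r ≤ 1
  total_le : ∀ i j, ∑ r ∈ Finset.range i, inel i j r + ∑ r ∈ Finset.range j, el i j r ≤ (M.k : ℝ≥0)

namespace Policy

variable {M : System} (π : Policy M)

/-- `π_I(i,j)`: number of servers allocated to inelastic jobs. -/
def totI (i j : ℕ) : ℝ≥0 := ∑ r ∈ Finset.range i, π.inel i j r

/-- `π_E(i,j)`: number of servers allocated to elastic jobs. -/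
def totE (i j : ℕ) : ℝ≥0 := ∑ r ∈ Finset.range j, π.el i j r

/-- No server idles while some job could use it: with an elastic job present all `k` servers are
in use, and in any case at least `min i k` servers are in use. -/
def WorkConserving : Prop :=
  ∀ i j : ℕ, min (i : ℝ≥0) (M.k : ℝ≥0) ≤ π.totI i j + π.totE i j ∧
    (0 < j → π.totI i j + π.totE i j = (M.k : ℝ≥0))

/-- Inelastic jobs are served first-come-first-serve: if `N` servers are allocated to inelastic
jobs, the `⌊N⌋` earliest inelastic jobs get one server each, the next one gets what remains, and
later ones get nothing. -/
def InelasticFCFS : Prop :=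
  ∀ i j r, r < i →
    (r < ⌊π.totI i j⌋₊ → π.inel i j r = 1) ∧ (⌊π.totI i j⌋₊ < r → π.inel i j r = 0)

/-- The Markov chain `(N_I, N_E)` of the numbers of inelastic and elastic jobs in the system.
(The departure rates out of `i = 0` and `j = 0` are `0`.) -/
def numTrans (s : ℕ × ℕ) : List (ℝ≥0 × (ℕ × ℕ)) :=
  [(M.lamI, (s.1 + 1, s.2)),
   (M.lamE, (s.1, s.2 + 1)),
   (M.muI * π.totI s.1 s.2, (s.1 - 1, s.2)),
   (M.muE * π.totE s.1 s.2, (s.1, s.2 - 1))]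

/-- `p` is a steady-state distribution of `(N_I, N_E)` under `π`. -/
def IsSteadyState (p : PMF (ℕ × ℕ)) : Prop := IsStationary π.numTrans p

end Policy

/-- The class `𝒫` of work-conserving policies that serve inelastic jobs FCFS. -/
def classP (M : System) : Set (Policy M) := {π | π.WorkConserving ∧ π.InelasticFCFS}

/-- The mean number of jobs in system, `E[N]`, when `(N_I, N_E)` has law `p`. -/
def meanNumber (p : PMF (ℕ × ℕ)) : ℝ≥0∞ := ∑' s, p s * ((s.1 : ℝ≥0∞) + (s.2 : ℝ≥0∞))

/-! ## Response times -/

/-- The state of the system as seen from one job, the tagged job. -/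
inductive Tagged : Type
  /-- The tagged job is inelastic; `b` inelastic jobs arrived before it and `c` after it,
  and there are `j` elastic jobs. -/
  | inel (b c j : ℕ) : Tagged
  /-- The tagged job is elastic; there are `i` inelastic jobs, and `b` elastic jobs arrived
  before it and `c` after it. -/
  | el (i b c : ℕ) : Tagged
  /-- The tagged job is completed. -/
  | done : Tagged

instance : MeasurableSpace Tagged := ⊤

instance : DiscreteMeasurableSpace Tagged := ⟨fun _ => trivial⟩

namespace Policy

variable {M : System} (π : Policy M)

/-- The Markov chain of the system as seen from the tagged job. The transitions are, in order:
inelastic arrival, elastic arrival, completion of the tagged job, completion of an earlier job and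
of a later job of the class of the tagged job, completion of a job of the other class. -/
def tagTrans : Tagged → List (ℝ≥0 × Tagged)
  | .inel b c j =>
    [(M.lamI, .inel b (c + 1) j),
     (M.lamE, .inel b c (j + 1)),
     (M.muI * π.inel (b + c + 1) j b, .done),
     (M.muI * ∑ r ∈ Finset.range b, π.inel (b + c + 1) j r, .inel (b - 1) c j),
     (M.muI * ∑ r ∈ Finset.Ico (b + 1) (b + c + 1), π.inel (b + c + 1) j r, .inel b (c - 1) j),
     (M.muE * π.totE (b + c + 1) j, .inel b c (j - 1))]
  | .el i b c =>
    [(M.lamI, .el (i + 1) b c),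
     (M.lamE, .el i b (c + 1)),
     (M.muE * π.el i (b + c + 1) b, .done),
     (M.muE * ∑ r ∈ Finset.range b, π.el i (b + c + 1) r, .el i (b - 1) c),
     (M.muE * ∑ r ∈ Finset.Ico (b + 1) (b + c + 1), π.el i (b + c + 1) r, .el i b (c - 1)),
     (M.muI * π.totI i (b + c + 1), .el (i - 1) b c)]
  | .done => []

/-- The response time of the tagged job: the time until it is completed. -/
def responseTime (ω : (ℕ → Tagged) × (ℕ → ℝ)) : ℝ≥0∞ := timeIn π.tagTrans {Tagged.done}ᶜ ω

/-- The expectation of the remaining response time of the tagged job from the tagged state `x`. -/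
def meanTimeFrom (x : Tagged) : ℝ≥0∞ := ∫⁻ ω, π.responseTime ω ∂(chainMeasure π.tagTrans x)

/-- The mean response time `E[T]` of a job that arrives to the system in the steady state `p`:
it finds `i` inelastic and `j` elastic jobs with probability `p (i, j)`, and independently it is
inelastic with probability `λ_I / (λ_I + λ_E)` and elastic with
probability `λ_E / (λ_I + λ_E)`. -/
def meanResponseTime (p : PMF (ℕ × ℕ)) : ℝ≥0∞ :=
  ∑' s : ℕ × ℕ, p s *
    (((M.lamI / (M.lamI + M.lamE) : ℝ≥0) : ℝ≥0∞) * π.meanTimeFrom (.inel s.1 0 s.2) +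
     ((M.lamE / (M.lamI + M.lamE) : ℝ≥0) : ℝ≥0∞) * π.meanTimeFrom (.el s.1 s.2 0))

end Policy

end ElasticQueue

end

open ElasticQueue

/-!
The chain is uniformised: in every state at least the arrival rates are present and all total rates
are bounded, so steady states are the invariant laws of a discrete-time chain whose steps take the
time `M.step` on average, and mean hitting times are sums of survival probabilities of that chain
(`lintegral_timeIn_eq_unif`, `IsBalanced.tsum_mul_unif`).

*Average-cost dynamic programming.* The optimal `α`-discounted cost `V` is increasing in both
numbers of jobs (`System.IsMono.bellman`). Hence the expected cost of an allocation `(u, v)` is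
linear with nonpositive slopes, and it is minimised by one of two work-conserving allocations,
inelastic first or elastic first (`System.bellman_le`). A quadratic Lyapunov function bounds
`(1 - α) V 0`. As the empty state is the cheapest and every state is reached from it by arrivals,
the relative values `V s - V 0` are bounded uniformly in `α`, and along an ultrafilter `α → 1` they
converge to a solution `h + g = jobs + bellman h` (`System.exists_averageCost`). The greedy policy
of `h` belongs to the class `𝒫`; under it the time averages of the number of jobs from the empty
state are at most `g`, so they are tight and have a stationary limit with mean at most `g`
(`Policy.exists_steadyState`). It is the only one, because the chain is irreducible
(`stationary_unique`).

*Comparison with other policies.* Little's law may fail in one direction for an arbitrary policy in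
a steady state, since jobs that are never served occupy the system but are never observed as
arrivals. What holds is that the total arrival rate times `E[T]` is the limit of the mean number of
jobs that arrived after time zero and are still present (`Policy.lam_mul_meanResponseTime`). This
number is at most `E[N]` (`Policy.lam_mul_meanResponseTime_le`). It is also the cost of a system
that starts empty and in which the jobs present at time zero only influence the decisions, so it is
bounded below by the optimal discounted costs, hence by `g` (`Policy.valueIter_le_newJobs`,
`Policy.ofReal_le_lam_mul_meanResponseTime`). Writing `λ` for the total arrival rate, the greedy
policy satisfies `λ E[T] ≤ E[N] ≤ g` and every other policy `g ≤ λ E[T'] ≤ E[N']`.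
-/

noncomputable section

open Filter Topology

namespace ElasticQueue

/-! ### Flows, balanced measures and uniformisation -/

section GenericChain

variable {S : Type}

/-- The flow of the function `F` out of `x`: the sum of (rate) · `F`(target) over the transitions
out of `x`. -/
def flow (t : S → List (ℝ≥0 × S)) (F : S → ℝ≥0∞) (x : S) : ℝ≥0∞ :=
  ((t x).map fun w => (w.1 : ℝ≥0∞) * F w.2).sum

theorem flow_mono (t : S → List (ℝ≥0 × S)) {F G : S → ℝ≥0∞} (h : ∀ x, F x ≤ G x) (x : S) :
    flow t F x ≤ flow t G x := by
  unfold flow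
  induction t x with
  | nil => simp
  | cons w l ih =>
    simp only [List.map_cons, List.sum_cons]
    gcongr
    exact h _

theorem flow_tsum (t : S → List (ℝ≥0 × S)) (F : ℕ → S → ℝ≥0∞) (x : S) :
    flow t (fun y => ∑' n, F n y) x = ∑' n, flow t (F n) x := by
  unfold flow
  induction t x with
  | nil => simp
  | cons w l ih =>
    simp only [List.map_cons, List.sum_cons, ih]
    rw [ENNReal.tsum_add, ENNReal.tsum_mul_left]

theorem flow_one (t : S → List (ℝ≥0 × S)) (x : S) : flow t (fun _ => 1) x = outRate t x := by
  unfold flow outRate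
  induction t x with
  | nil => simp
  | cons w l ih =>
    simp only [List.map_cons, List.sum_cons]
    rw [ih, mul_one, ENNReal.coe_add]

theorem flow_eq_tsum_rate (t : S → List (ℝ≥0 × S)) (F : S → ℝ≥0∞) (x : S) :
    flow t F x = ∑' y, (rate t x y : ℝ≥0∞) * F y := by
  classical
  unfold flow rate
  induction t x with
  | nil => simp
  | cons w l ih =>
    simp only [List.map_cons, List.sum_cons, ENNReal.coe_add, add_mul]
    rw [ih, ENNReal.tsum_add]
    congr 1
    rw [tsum_eq_single w.2]
    · simp
    · intro y hy
      simp [hy.symm]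

/-- A measure `r` on the states, not necessarily of mass one, that satisfies the balance
equations. -/
def IsBalanced (t : S → List (ℝ≥0 × S)) (r : S → ℝ≥0∞) : Prop :=
  ∀ y, ∑' x, r x * (rate t x y : ℝ≥0∞) = r y * (outRate t y : ℝ≥0∞)

/-- The balance equations tested against a function. -/
theorem IsBalanced.tsum_mul_flow {t : S → List (ℝ≥0 × S)} {r : S → ℝ≥0∞} (h : IsBalanced t r)
    (F : S → ℝ≥0∞) :
    ∑' x, r x * flow t F x = ∑' x, r x * (outRate t x : ℝ≥0∞) * F x := by
  simp_rw [flow_eq_tsum_rate, ← ENNReal.tsum_mul_left]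
  rw [ENNReal.tsum_comm]
  refine tsum_congr fun y => ?_
  rw [← h y, ← ENNReal.tsum_mul_right]
  exact tsum_congr fun x => by ring

/-- The transition operator of the uniformised chain: at each step of length `δ` the chain follows
the transition `w` with probability `δ * w.1` and otherwise stays. -/
def unif (t : S → List (ℝ≥0 × S)) (δ : ℝ) : Module.End ℝ (S → ℝ) where
  toFun f x := f x + δ * ((t x).map fun w => (w.1 : ℝ) * (f w.2 - f x)).sum
  map_add' f g := by
    funext x
    have : ∀ l : List (ℝ≥0 × S),
        (l.map fun w => (w.1 : ℝ) * ((f + g) w.2 - (f + g) x)).sum =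
        (l.map fun w => (w.1 : ℝ) * (f w.2 - f x)).sum +
        (l.map fun w => (w.1 : ℝ) * (g w.2 - g x)).sum := by
      intro l
      induction l with
      | nil => simp
      | cons w l ih =>
        simp only [List.map_cons, List.sum_cons]
        rw [ih]
        simp only [Pi.add_apply]
        ring
    simp only [Pi.add_apply] at this ⊢
    rw [this]
    ring
  map_smul' c f := by
    funext x
    have : ∀ l : List (ℝ≥0 × S),
        (l.map fun w => (w.1 : ℝ) * ((c • f) w.2 - (c • f) x)).sum =
        c * (l.map fun w => (w.1 : ℝ) * (f w.2 - f x)).sum := by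
      intro l
      induction l with
      | nil => simp
      | cons w l ih =>
        simp only [List.map_cons, List.sum_cons]
        rw [ih]
        simp only [Pi.smul_apply, smul_eq_mul]
        ring
    simp only [Pi.smul_apply, smul_eq_mul, RingHom.id_apply] at this ⊢
    rw [this]
    ring

theorem unif_apply (t : S → List (ℝ≥0 × S)) (δ : ℝ) (f : S → ℝ) (x : S) :
    unif t δ f x = f x + δ * ((t x).map fun w => (w.1 : ℝ) * (f w.2 - f x)).sum := rfl

theorem unif_apply_eq (t : S → List (ℝ≥0 × S)) (δ : ℝ) (f : S → ℝ) (x : S) :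
    unif t δ f x = δ * ((t x).map fun w => (w.1 : ℝ) * f w.2).sum +
      (1 - δ * outRate t x) * f x := by
  have : ∀ l : List (ℝ≥0 × S), (l.map fun w => (w.1 : ℝ) * (f w.2 - f x)).sum =
      (l.map fun w => (w.1 : ℝ) * f w.2).sum - ((l.map Prod.fst).sum : ℝ≥0) * f x := by
    intro l
    induction l with
    | nil => simp
    | cons w l ih =>
      simp only [List.map_cons, List.sum_cons, ih, NNReal.coe_add]
      ring
  rw [unif_apply, this, outRate]
  ring

theorem unif_const (t : S → List (ℝ≥0 × S)) (δ c : ℝ) :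
    unif t δ (fun _ => c) = fun _ => c := by
  funext x
  simp [unif_apply]

variable {t : S → List (ℝ≥0 × S)} {δ : ℝ≥0}

theorem unif_nonneg (hδ : ∀ x, δ * outRate t x ≤ 1) {f : S → ℝ} (hf : ∀ x, 0 ≤ f x) (x : S) :
    0 ≤ unif t δ f x := by
  rw [unif_apply_eq]
  have h1 : (δ : ℝ) * outRate t x ≤ 1 := by exact_mod_cast hδ x
  have h2 : 0 ≤ ((t x).map fun w => (w.1 : ℝ) * f w.2).sum := by
    apply List.sum_nonneg
    simp only [List.mem_map]
    rintro _ ⟨w, -, rfl⟩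
    exact mul_nonneg w.1.coe_nonneg (hf _)
  have := mul_nonneg (sub_nonneg.2 h1) (hf x)
  have := mul_nonneg δ.coe_nonneg h2
  linarith

theorem unif_mono (hδ : ∀ x, δ * outRate t x ≤ 1) {f g : S → ℝ} (h : ∀ x, f x ≤ g x) (x : S) :
    unif t δ f x ≤ unif t δ g x := by
  have := unif_nonneg hδ (f := g - f) (fun x => sub_nonneg.2 (h x)) x
  rw [map_sub] at this
  exact sub_nonneg.1 this

theorem unif_pow_nonneg (hδ : ∀ x, δ * outRate t x ≤ 1) {f : S → ℝ} (hf : ∀ x, 0 ≤ f x) (n : ℕ)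
    (x : S) : 0 ≤ (unif t δ ^ n) f x := by
  induction n generalizing x with
  | zero => simpa using hf x
  | succ n ih => rw [pow_succ', Module.End.mul_apply]; exact unif_nonneg hδ ih x

theorem unif_pow_mono (hδ : ∀ x, δ * outRate t x ≤ 1) {f g : S → ℝ} (h : ∀ x, f x ≤ g x) (n : ℕ)
    (x : S) : (unif t δ ^ n) f x ≤ (unif t δ ^ n) g x := by
  have := unif_pow_nonneg hδ (f := g - f) (fun x => sub_nonneg.2 (h x)) n x
  rw [map_sub] at this
  exact sub_nonneg.1 this

theorem unif_pow_const (n : ℕ) (c : ℝ) : (unif t δ ^ n) (fun _ => c) = fun _ => c := by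
  induction n with
  | zero => rfl
  | succ n ih => rw [pow_succ', Module.End.mul_apply, ih, unif_const]

/-- The transition operator of the uniformised chain on functions with values in `[0, ∞]`. -/
def unifE (t : S → List (ℝ≥0 × S)) (δ : ℝ≥0) (F : S → ℝ≥0∞) (x : S) : ℝ≥0∞ :=
  δ * flow t F x + ((1 - δ * outRate t x : ℝ≥0) : ℝ≥0∞) * F x

theorem ofReal_unif (hδ : ∀ x, δ * outRate t x ≤ 1) {f : S → ℝ} (hf : ∀ x, 0 ≤ f x) (x : S) :
    ENNReal.ofReal (unif t δ f x) = unifE t δ (fun y => ENNReal.ofReal (f y)) x := by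
  have h2 : ∀ l : List (ℝ≥0 × S), 0 ≤ (l.map fun w => (w.1 : ℝ) * f w.2).sum := by
    intro l
    apply List.sum_nonneg
    simp only [List.mem_map]
    rintro _ ⟨w, -, rfl⟩
    exact mul_nonneg w.1.coe_nonneg (hf _)
  have h3 : ∀ l : List (ℝ≥0 × S), ENNReal.ofReal (l.map fun w => (w.1 : ℝ) * f w.2).sum =
      (l.map fun w => (w.1 : ℝ≥0∞) * ENNReal.ofReal (f w.2)).sum := by
    intro l
    induction l with
    | nil => simp
    | cons w l ih =>
      simp only [List.map_cons, List.sum_cons]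
      rw [ENNReal.ofReal_add (mul_nonneg w.1.coe_nonneg (hf _)) (h2 l), ih,
        ENNReal.ofReal_mul w.1.coe_nonneg, ENNReal.ofReal_coe_nnreal]
  have h1 : (0 : ℝ) ≤ 1 - δ * outRate t x := by
    have : (δ : ℝ) * outRate t x ≤ 1 := by exact_mod_cast hδ x
    linarith
  rw [unif_apply_eq, ENNReal.ofReal_add (mul_nonneg δ.coe_nonneg (h2 _)) (mul_nonneg h1 (hf x)),
    ENNReal.ofReal_mul δ.coe_nonneg, ENNReal.ofReal_mul h1, h3, ENNReal.ofReal_coe_nnreal,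
    unifE, flow]
  congr 2

theorem unifE_mono {F G : S → ℝ≥0∞} (h : ∀ x, F x ≤ G x) (x : S) :
    unifE t δ F x ≤ unifE t δ G x := by
  unfold unifE
  gcongr
  · exact flow_mono t h x
  · exact h x

theorem unifE_tsum (F : ℕ → S → ℝ≥0∞) (x : S) :
    unifE t δ (fun y => ∑' n, F n y) x = ∑' n, unifE t δ (F n) x := by
  simp only [unifE, flow_tsum, ENNReal.tsum_add, ENNReal.tsum_mul_left]

theorem unifE_split (hδ : ∀ x, δ * outRate t x ≤ 1) (a : ℝ≥0∞) (x : S) :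
    δ * (outRate t x * a) + ((1 - δ * outRate t x : ℝ≥0) : ℝ≥0∞) * a = a := by
  rw [← mul_assoc, ← add_mul, ← ENNReal.coe_mul, ← ENNReal.coe_add, add_tsub_cancel_of_le (hδ x),
    ENNReal.coe_one, one_mul]

/-- A balanced measure is invariant under the uniformised chain. -/
theorem IsBalanced.tsum_mul_unifE (hδ : ∀ x, δ * outRate t x ≤ 1) {r : S → ℝ≥0∞}
    (h : IsBalanced t r) (F : S → ℝ≥0∞) :
    ∑' x, r x * unifE t δ F x = ∑' x, r x * F x := by
  have : ∀ x, r x * F x = δ * (r x * outRate t x * F x) +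
      r x * (((1 - δ * outRate t x : ℝ≥0) : ℝ≥0∞) * F x) := by
    intro x
    conv_lhs => rw [← unifE_split hδ (F x) x]
    ring
  simp_rw [this, unifE, mul_add, ENNReal.tsum_add]
  rw [ENNReal.tsum_mul_left, ← h.tsum_mul_flow, ← ENNReal.tsum_mul_left]
  congr 1
  exact tsum_congr fun x => by ring

theorem IsBalanced.tsum_mul_unif (hδ : ∀ x, δ * outRate t x ≤ 1) {r : S → ℝ≥0∞}
    (h : IsBalanced t r) {f : S → ℝ} (hf : ∀ x, 0 ≤ f x) :
    ∑' x, r x * ENNReal.ofReal (unif t δ f x) = ∑' x, r x * ENNReal.ofReal (f x) := by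
  simp_rw [ofReal_unif hδ hf]
  exact h.tsum_mul_unifE hδ _

/-! ### Uniqueness of the stationary distribution -/

theorem pmf_eq_of_le {p q : PMF S} (h : ∀ x, p x ≤ q x) : p = q := by
  ext x
  by_contra hne
  have h1 : ∑' x, p x < ∑' x, q x :=
    ENNReal.tsum_lt_tsum (by rw [p.tsum_coe]; exact ENNReal.one_ne_top) h
      (lt_of_le_of_ne (h x) hne)
  rw [p.tsum_coe, q.tsum_coe] at h1
  exact lt_irrefl _ h1

/-- If every balanced measure that does not vanish is positive everywhere (irreducibility), then
there is at most one stationary distribution: the minimum `r` of two of them is balanced, hence so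
is the excess `p - r`; it vanishes identically or nowhere, and in both cases `p` and `q` are
comparable. -/
theorem stationary_unique {t : S → List (ℝ≥0 × S)} {c : ℝ≥0} (hc : ∀ x, outRate t x ≤ c)
    (hirr : ∀ r : S → ℝ≥0∞, IsBalanced t r → ∀ x, r x ≠ 0 → ∀ y, r y ≠ 0)
    {p q : PMF S} (hp : IsStationary t p) (hq : IsStationary t q) : p = q := by
  set r : S → ℝ≥0∞ := fun x => min (p x) (q x) with hr
  have hsum : ∑' x, r x * (outRate t x : ℝ≥0∞) ≠ ⊤ := by
    refine ne_top_of_le_ne_top (ENNReal.coe_ne_top (r := c)) ?_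
    calc ∑' x, r x * (outRate t x : ℝ≥0∞) ≤ ∑' x, p x * c := by
          refine ENNReal.tsum_le_tsum fun x => ?_
          gcongr
          · exact min_le_left _ _
          · exact hc x
      _ = c := by rw [ENNReal.tsum_mul_right, p.tsum_coe, one_mul]
  have hle : ∀ y, ∑' x, r x * (rate t x y : ℝ≥0∞) ≤ r y * (outRate t y : ℝ≥0∞) := by
    intro y
    rcases le_total (p y) (q y) with h | h
    · rw [hr]; simp only [min_eq_left h]; rw [← hp y]
      exact ENNReal.tsum_le_tsum fun x => by gcongr; exact min_le_left _ _
    · rw [hr]; simp only [min_eq_right h]; rw [← hq y]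
      exact ENNReal.tsum_le_tsum fun x => by gcongr; exact min_le_right _ _
  have htot : ∑' y, ∑' x, r x * (rate t x y : ℝ≥0∞) = ∑' x, r x * (outRate t x : ℝ≥0∞) := by
    rw [ENNReal.tsum_comm]
    refine tsum_congr fun x => ?_
    rw [ENNReal.tsum_mul_left, ← flow_one, flow_eq_tsum_rate]
    simp
  -- inflow and outflow of `r` have the same finite total, so the inequalities `hle` are equalities
  have hrb : IsBalanced t r := by
    intro y
    by_contra hne
    have := ENNReal.tsum_lt_tsum (by rw [htot]; exact hsum) hle (lt_of_le_of_ne (hle y) hne)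
    rw [htot] at this
    exact lt_irrefl _ this
  set d : S → ℝ≥0∞ := fun x => p x - r x with hd
  have hdr : ∀ x, p x = d x + r x := fun x => (tsub_add_cancel_of_le (min_le_left _ _)).symm
  have hdb : IsBalanced t d := by
    intro y
    have h1 := hp y
    simp_rw [hdr, add_mul] at h1
    rw [ENNReal.tsum_add, hrb y] at h1
    refine (ENNReal.add_left_inj ?_).1 h1
    exact ENNReal.mul_ne_top (ne_top_of_le_ne_top (p.apply_ne_top y) (min_le_left _ _))
      ENNReal.coe_ne_top
  by_cases h0 : ∃ x, d x ≠ 0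
  · obtain ⟨x, hx⟩ := h0
    refine (pmf_eq_of_le fun y => ?_).symm
    by_contra hlt
    refine hirr d hdb x hx y ?_
    rw [hd]
    simp only [hr, min_eq_left (not_le.1 hlt).le, tsub_self]
  · push Not at h0
    refine pmf_eq_of_le fun y => ?_
    rw [hdr y, h0 y, zero_add]
    exact min_le_right _ _

end GenericChain

/-! ### The mean time spent in a set of states -/

section MeanTime

theorem lintegral_ofReal_expMeasure_one : ∫⁻ y, ENNReal.ofReal y ∂(expMeasure 1) = 1 := by
  have h0 : ∀ᵐ y : ℝ, gammaPDF 1 1 y * ENNReal.ofReal y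
      = gammaPDF 2 1 y := by
    refine ae_of_all _ fun y => ?_
    rcases lt_or_ge y 0 with hy | hy
    · simp [gammaPDF_of_neg hy]
    · rw [gammaPDF_of_nonneg hy, gammaPDF_of_nonneg hy, ← ENNReal.ofReal_mul (by positivity)]
      congr 1
      norm_num [Real.Gamma_two]
      ring
  have hm : Measurable (gammaPDF 1 1) := (measurable_gammaPDFReal 1 1).ennreal_ofReal
  rw [expMeasure, gammaMeasure,
    lintegral_withDensity_eq_lintegral_mul _ hm ENNReal.measurable_ofReal]
  refine (lintegral_congr_ae h0).trans ?_
  exact lintegral_gammaPDF_eq_one two_pos one_pos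

variable {S : Type}

/-- Minimality of the Neumann series: it lies below every supersolution `u` of `u = f + T u`. -/
theorem tsum_iterate_le {T : (S → ℝ≥0∞) → S → ℝ≥0∞}
    (hT : ∀ F G : S → ℝ≥0∞, (∀ x, F x ≤ G x) → ∀ x, T F x ≤ T G x)
    (hadd : ∀ (F : ℕ → S → ℝ≥0∞) x, T (fun y => ∑' n, F n y) x = ∑' n, T (F n) x)
    {f u : S → ℝ≥0∞} (hu : ∀ x, f x + T u x ≤ u x) (x : S) : ∑' n, (T^[n] f) x ≤ u x := by
  have hfin : ∀ (N : ℕ) x, ∑ n ∈ Finset.range N, (T^[n] f) x ≤ u x := by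
    intro N
    induction N with
    | zero => simp
    | succ N ih =>
      intro x
      rw [Finset.sum_range_succ', add_comm]
      refine le_trans ?_ (hu x)
      simp only [Function.iterate_zero, id_eq]
      gcongr
      have h1 : ∑ n ∈ Finset.range N, (T^[n + 1] f) x ≤
          T (fun y => ∑' n, if n < N then (T^[n] f) y else 0) x := by
        rw [hadd (fun n y => if n < N then (T^[n] f) y else 0)]
        refine le_trans (Finset.sum_le_sum fun n hn => ?_) (ENNReal.sum_le_tsum (Finset.range N))
        simp only [Finset.mem_range.1 hn, if_true]
        rw [Function.iterate_succ_apply']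
      refine h1.trans (hT _ _ (fun y => ?_) x)
      rw [tsum_eq_sum (s := Finset.range N) (fun n hn => by simp [Finset.mem_range.not.1 hn])]
      refine le_trans (le_of_eq (Finset.sum_congr rfl fun n hn => ?_)) (ih y)
      simp [Finset.mem_range.1 hn]
  exact ENNReal.tsum_le_of_sum_range_le fun N => hfin N x

/-- The Neumann series solves the equation `u = f + T u`. -/
theorem tsum_iterate_eq {T : (S → ℝ≥0∞) → S → ℝ≥0∞}
    (hadd : ∀ (F : ℕ → S → ℝ≥0∞) x, T (fun y => ∑' n, F n y) x = ∑' n, T (F n) x)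
    (f : S → ℝ≥0∞) (x : S) :
    ∑' n, (T^[n] f) x = f x + T (fun y => ∑' n, (T^[n] f) y) x := by
  rw [hadd, tsum_eq_zero_add' ENNReal.summable]
  simp only [Function.iterate_zero, id_eq, Function.iterate_succ_apply']

variable [MeasurableSpace S]

/-- The expectation of `F` after one jump of the embedded chain. -/
def jumpOp (t : S → List (ℝ≥0 × S)) (F : S → ℝ≥0∞) (x : S) : ℝ≥0∞ :=
  ∫⁻ y, F y ∂(jumpMeasure t x)

theorem jumpOp_mono (t : S → List (ℝ≥0 × S)) {F G : S → ℝ≥0∞} (h : ∀ x, F x ≤ G x) (x : S) :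
    jumpOp t F x ≤ jumpOp t G x := lintegral_mono h

variable [DiscreteMeasurableSpace S]

theorem lintegral_jumpMeasure {t : S → List (ℝ≥0 × S)} {x : S} (h : outRate t x ≠ 0)
    (F : S → ℝ≥0∞) : ∫⁻ y, F y ∂(jumpMeasure t x) = flow t F x / outRate t x := by
  rw [jumpMeasure, if_neg h, flow]
  generalize outRate t x = c at h
  induction t x with
  | nil => simp
  | cons w l ih =>
    simp only [List.map_cons, List.sum_cons, lintegral_add_measure, ih, lintegral_smul_measure,
      lintegral_dirac, ENNReal.add_div]
    rw [ENNReal.smul_def, ENNReal.coe_div h, smul_eq_mul]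
    simp only [div_eq_mul_inv]
    ring

theorem lintegral_jumpChain_succ (t : S → List (ℝ≥0 × S)) (x : S) (F : S → ℝ≥0∞) (n : ℕ) :
    ∫⁻ ω, F (ω (n + 1)) ∂(jumpChain t x) =
      ∫⁻ ω, (∫⁻ y, F y ∂(jumpMeasure t (ω n))) ∂(jumpChain t x) := by
  have hF : Measurable F := Measurable.of_discrete
  have hG : Measurable fun z => ∫⁻ y, F y ∂(jumpMeasure t z) := Measurable.of_discrete
  unfold jumpChain
  have h0 := Kernel.traj_comp_partialTraj (X := fun _ => S) (κ := historyKernel t) (Nat.zero_le n)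
  conv_lhs => rw [← h0]
  rw [Kernel.lintegral_comp _ _ _ (show Measurable fun ω : ℕ → S => F (ω (n + 1)) from
    hF.comp (measurable_pi_apply _))]
  have h1 : ∀ h : (i : Finset.Iic n) → (fun _ : ℕ => S) i,
      ∫⁻ ω, F (ω (n + 1)) ∂(Kernel.traj (X := fun _ => S) (historyKernel t) n h) =
      ∫⁻ y, F y ∂(jumpMeasure t (h ⟨n, Finset.mem_Iic.2 le_rfl⟩)) := by
    intro h
    have h2 := Kernel.map_traj_succ_self (X := fun _ => S) (κ := historyKernel t) (a := n)
    have h3 : historyKernel t n h = jumpMeasure t (h ⟨n, Finset.mem_Iic.2 le_rfl⟩) := rfl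
    rw [← h3, ← h2, Kernel.map_apply _ (measurable_pi_apply _),
      lintegral_map hF (measurable_pi_apply _)]
  simp_rw [h1]
  rw [← Kernel.traj_map_frestrictLe_apply,
    lintegral_map (show Measurable fun h : (i : Finset.Iic n) → (fun _ : ℕ => S) i =>
      ∫⁻ y, F y ∂(jumpMeasure t (h ⟨n, Finset.mem_Iic.2 le_rfl⟩)) from
      hG.comp (measurable_pi_apply _)) (Preorder.measurable_frestrictLe n)]
  rfl

/-- The law of the `n`-th state of the embedded chain. -/
theorem lintegral_jumpChain (t : S → List (ℝ≥0 × S)) (x : S) (F : S → ℝ≥0∞) (n : ℕ) :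
    ∫⁻ ω, F (ω n) ∂(jumpChain t x) = ((jumpOp t)^[n] F) x := by
  induction n generalizing F with
  | zero =>
    unfold jumpChain
    have hF : Measurable F := Measurable.of_discrete
    have h := Kernel.traj_map_frestrictLe_apply (X := fun _ => S) (κ := historyKernel t) 0 0
      (fun _ => x)
    have hF0 : Measurable fun z : (i : Finset.Iic 0) → (fun _ : ℕ => S) i =>
        F (z ⟨0, Finset.mem_Iic.2 le_rfl⟩) := hF.comp (measurable_pi_apply _)
    have h2 : ∫⁻ ω, F (ω 0) ∂(Kernel.traj (X := fun _ => S) (historyKernel t) 0 fun _ => x) =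
        ∫⁻ z, F (z ⟨0, Finset.mem_Iic.2 le_rfl⟩) ∂((Kernel.traj (X := fun _ => S)
          (historyKernel t) 0 fun _ => x).map (Preorder.frestrictLe 0)) := by
      rw [lintegral_map hF0 (Preorder.measurable_frestrictLe 0)]
      rfl
    rw [h2, h, Kernel.partialTraj_self, Kernel.id_apply,
      lintegral_dirac' _ hF0]
    rfl
  | succ n ih =>
    rw [lintegral_jumpChain_succ, Function.iterate_succ_apply]
    exact ih (jumpOp t F)

open Classical in
/-- The mean time in `A`, as the sum over the jumps of the expected length of the visit. -/
theorem lintegral_timeIn (t : S → List (ℝ≥0 × S)) (A : Set S) (x : S) :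
    ∫⁻ ω, timeIn t A ω ∂(chainMeasure t x) =
      ∑' n, ((jumpOp t)^[n] fun y => if y ∈ A then (outRate t y : ℝ≥0∞)⁻¹ else 0) x := by
  have hexp : IsProbabilityMeasure (expMeasure 1) := isProbabilityMeasure_expMeasure one_pos
  set f : S → ℝ≥0∞ := fun y => if y ∈ A then (outRate t y : ℝ≥0∞)⁻¹ else 0 with hf
  have hfm : Measurable f := Measurable.of_discrete
  have h1 : ∀ ω : (ℕ → S) × (ℕ → ℝ), timeIn t A ω =
      ∑' n, f (ω.1 n) * ENNReal.ofReal (ω.2 n) := by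
    intro ω
    refine tsum_congr fun n => ?_
    simp only [hf, holdingTime]
    split_ifs
    · rw [div_eq_mul_inv, mul_comm]
    · simp
  simp_rw [h1]
  have hm1 : ∀ n, Measurable fun ω : ℕ → S => f (ω n) :=
    fun n => hfm.comp (measurable_pi_apply n)
  have hm2 : ∀ n, Measurable fun ω : ℕ → ℝ => ENNReal.ofReal (ω n) :=
    fun n => ENNReal.measurable_ofReal.comp (measurable_pi_apply n)
  have hm3 : ∀ n, Measurable fun ω : (ℕ → S) × (ℕ → ℝ) => f (ω.1 n) * ENNReal.ofReal (ω.2 n) :=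
    fun n => ((hm1 n).comp measurable_fst).mul ((hm2 n).comp measurable_snd)
  rw [lintegral_tsum fun n => (hm3 n).aemeasurable]
  refine tsum_congr fun n => ?_
  have hprob : IsProbabilityMeasure (jumpChain t x) := by unfold jumpChain; infer_instance
  rw [chainMeasure, lintegral_prod_mul (hm1 n).aemeasurable (hm2 n).aemeasurable,
    lintegral_jumpChain]
  have h2 : ∫⁻ ω : ℕ → ℝ, ENNReal.ofReal (ω n) ∂(Measure.infinitePi fun _ : ℕ => expMeasure 1)
      = 1 := by
    rw [← lintegral_ofReal_expMeasure_one,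
      ← (measurePreserving_eval_infinitePi (fun _ : ℕ => expMeasure 1) n).lintegral_comp
        ENNReal.measurable_ofReal]
  rw [h2, mul_one]

theorem jumpOp_tsum (t : S → List (ℝ≥0 × S)) (F : ℕ → S → ℝ≥0∞) (x : S) :
    jumpOp t (fun y => ∑' n, F n y) x = ∑' n, jumpOp t (F n) x :=
  lintegral_tsum fun _ => Measurable.of_discrete.aemeasurable

/-- The mean time spent in `A` before absorption in its complement, computed along the uniformised
chain: the uniformised chain makes a step every `δ` time units on average. Both sides are the
minimal solution of the same linear system. -/
theorem lintegral_timeIn_eq_unif {t : S → List (ℝ≥0 × S)} {δ : ℝ≥0} (hδ0 : δ ≠ 0)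
    (hδ : ∀ x, δ * outRate t x ≤ 1) {A : Set S} (hA : ∀ x ∈ A, outRate t x ≠ 0)
    (hAc : ∀ x ∉ A, t x = []) (x : S) :
    ∫⁻ ω, timeIn t A ω ∂(chainMeasure t x) =
      δ * ∑' n, ENNReal.ofReal ((unif t δ ^ n) (A.indicator fun _ => 1) x) := by
  classical
  set e : S → ℝ := A.indicator fun _ => 1 with he
  set f : S → ℝ≥0∞ := fun y => if y ∈ A then (outRate t y : ℝ≥0∞)⁻¹ else 0 with hf
  set E : S → ℝ≥0∞ := fun y => if y ∈ A then (δ : ℝ≥0∞) else 0 with hE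
  have he0 : ∀ y, 0 ≤ e y := Set.indicator_nonneg fun _ _ => zero_le_one
  have hit : ∀ n y, (δ : ℝ≥0∞) * ENNReal.ofReal ((unif t δ ^ n) e y) = ((unifE t δ)^[n] E) y := by
    intro n
    induction n with
    | zero => intro y; by_cases hy : y ∈ A <;> simp [he, hE, hy]
    | succ n ih =>
      intro y
      rw [pow_succ', Module.End.mul_apply, ofReal_unif hδ (unif_pow_nonneg hδ he0 n),
        Function.iterate_succ_apply']
      have : (unifE t δ)^[n] E = fun y => (δ : ℝ≥0∞) * ENNReal.ofReal ((unif t δ ^ n) e y) :=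
        funext fun y => (ih y).symm
      rw [this]
      have hl : ∀ F : S → ℝ≥0∞, flow t (fun y => (δ : ℝ≥0∞) * F y) y = δ * flow t F y := by
        intro F
        rw [flow_eq_tsum_rate, flow_eq_tsum_rate, ← ENNReal.tsum_mul_left]
        exact tsum_congr fun z => by ring
      simp only [unifE, hl]
      ring
  rw [lintegral_timeIn, ← ENNReal.tsum_mul_left]
  simp_rw [hit]
  have hflow0 : ∀ x ∉ A, ∀ F : S → ℝ≥0∞, flow t F x = 0 := fun x hx F => by
    simp [flow, hAc x hx]
  have hout0 : ∀ x ∉ A, outRate t x = 0 := fun x hx => by simp [outRate, hAc x hx]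
  apply le_antisymm
  · revert x
    refine tsum_iterate_le (fun F G h => jumpOp_mono t h) (jumpOp_tsum t) fun x => ?_
    set u : S → ℝ≥0∞ := fun y => ∑' n, ((unifE t δ)^[n] E) y with hu
    have hux : u x = E x + unifE t δ u x := tsum_iterate_eq unifE_tsum E x
    change f x + jumpOp t u x ≤ u x
    by_cases hx : x ∈ A
    · -- staying in `x` can be cancelled only if `u x` is finite; otherwise the claim is trivial
      rcases eq_or_ne (u x) ⊤ with htop | htop
      · rw [htop]; exact le_top
      have hr : (outRate t x : ℝ≥0∞) ≠ 0 := by exact_mod_cast hA x hx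
      have h1 : (δ : ℝ≥0∞) * (1 + flow t u x) = δ * (outRate t x * u x) := by
        have h2 := unifE_split hδ (u x) x
        rw [hux] at h2
        conv_rhs at h2 => simp only [hE, hx, if_true, unifE]
        rw [← hux, ← add_assoc] at h2
        have h3 := (ENNReal.add_left_inj (ENNReal.mul_ne_top ENNReal.coe_ne_top htop)).1 h2
        rw [h3]; ring
      have h4 : 1 + flow t u x = outRate t x * u x :=
        (ENNReal.mul_right_inj (by exact_mod_cast hδ0) ENNReal.coe_ne_top).1 h1
      have h5 : f x + jumpOp t u x = (1 + flow t u x) / outRate t x := by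
        rw [jumpOp, lintegral_jumpMeasure (hA x hx), ENNReal.add_div, one_div]
        simp only [hf, hx, if_true]
      rw [h5, h4, mul_comm, ENNReal.mul_div_cancel_right hr ENNReal.coe_ne_top]
    · have : jumpOp t u x = u x := by
        rw [jumpOp, jumpMeasure, if_pos (hout0 x hx), lintegral_dirac]
      rw [this]
      simp [hf, hx]
  · revert x
    refine tsum_iterate_le (fun F G h => unifE_mono h) unifE_tsum fun x => ?_
    set u : S → ℝ≥0∞ := fun y => ∑' n, ((jumpOp t)^[n] f) y with hu
    have hux : u x = f x + jumpOp t u x := tsum_iterate_eq (jumpOp_tsum t) f x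
    change E x + unifE t δ u x ≤ u x
    by_cases hx : x ∈ A
    · have hr : (outRate t x : ℝ≥0∞) ≠ 0 := by exact_mod_cast hA x hx
      have h4 : outRate t x * u x = 1 + flow t u x := by
        rw [hux, jumpOp, lintegral_jumpMeasure (hA x hx)]
        simp only [hf, hx, if_true]
        rw [mul_add, ENNReal.mul_inv_cancel hr ENNReal.coe_ne_top,
          ENNReal.mul_div_cancel hr ENNReal.coe_ne_top]
      refine le_of_eq ?_
      conv_rhs => rw [← unifE_split hδ (u x) x, h4]
      simp only [hE, hx, if_true, unifE]
      ring
    · simp only [hE, hx, if_false, unifE, hflow0 x hx, hout0 x hx]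
      simp
end MeanTime

/-! ### Old and new jobs: the operator form of Little's law -/

/-- In a class with `a + n` jobs present, the sum over the `n` latest jobs of the function `f` of
the numbers of earlier and of later jobs. -/
def posSum (f : ℕ → ℕ → ℝ) (a n : ℕ) : ℝ := ∑ r ∈ Finset.range n, f (a + r) (n - 1 - r)

/-- An arrival puts a job at the end of the queue and one more job behind every other job. -/
theorem posSum_succ (f : ℕ → ℕ → ℝ) (a n : ℕ) :
    posSum f a (n + 1) = ∑ r ∈ Finset.range n, f (a + r) (n - 1 - r + 1) + f (a + n) 0 := by
  unfold posSum
  rw [Finset.sum_range_succ]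
  congr 1
  · refine Finset.sum_congr rfl fun r hr => ?_
    have := Finset.mem_range.1 hr
    congr 1
    omega
  · congr 1
    omega

/-- Effect of the completions in one class on `posSum`, counted job by job (left: the job
itself, an earlier job, a later job is completed) and counted in total (right: one of the `a`
earliest jobs or one of the `n` latest jobs is completed). The job at position `s` is completed at
rate `x s`. -/
theorem sum_completion (f : ℕ → ℕ → ℝ) (x : ℕ → ℝ) (a n : ℕ) :
    ∑ r ∈ Finset.range n, (x (a + r) * (0 - f (a + r) (n - 1 - r)) +
      (∑ s ∈ Finset.range (a + r), x s) * (f (a + r - 1) (n - 1 - r) - f (a + r) (n - 1 - r)) +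
      (∑ s ∈ Finset.Ico (a + r + 1) (a + n), x s) *
        (f (a + r) (n - 1 - r - 1) - f (a + r) (n - 1 - r))) =
    (∑ s ∈ Finset.range a, x s) * (posSum f (a - 1) n - posSum f a n) +
      (∑ s ∈ Finset.Ico a (a + n), x s) * (posSum f a (n - 1) - posSum f a n) := by
  rcases n with _ | m
  · simp [posSum]
  set X := ∑ s ∈ Finset.range a, x s with hX
  set Y : ℕ → ℝ := fun r => ∑ s ∈ Finset.range r, x (a + s) with hY
  have h1 : ∀ r, ∑ s ∈ Finset.range (a + r), x s = X + Y r := fun r => Finset.sum_range_add ..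
  have h2 : ∀ r, r ≤ m → ∑ s ∈ Finset.Ico (a + r + 1) (a + (m + 1)), x s =
      Y (m + 1) - Y (r + 1) := by
    intro r hr
    rw [Finset.sum_Ico_eq_sub _ (by omega), h1, add_assoc a r 1, h1]
    ring
  have h3 : ∑ s ∈ Finset.Ico a (a + (m + 1)), x s = Y (m + 1) := by
    rw [Finset.sum_Ico_eq_sub _ (by omega), h1, hX]
    ring
  have h4 : ∀ r, x (a + r) = Y (r + 1) - Y r := by
    intro r
    simp only [hY, Finset.sum_range_succ]
    ring
  have h5 : X * posSum f (a - 1) (m + 1) =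
      X * ∑ r ∈ Finset.range (m + 1), f (a + r - 1) (m - r) := by
    rcases a with _ | a
    · simp [hX]
    · congr 1
      refine Finset.sum_congr rfl fun r _ => ?_
      congr 1
      omega
  have h6 : ∑ r ∈ Finset.range (m + 1), Y r * f (a + r - 1) (m - r) =
      ∑ r ∈ Finset.range m, Y (r + 1) * f (a + r) (m - 1 - r) := by
    rw [Finset.sum_range_succ']
    simp only [hY, Finset.range_zero, Finset.sum_empty, zero_mul, add_zero]
    refine Finset.sum_congr rfl fun r _ => ?_
    congr 2
    omega
  have h7 : ∑ r ∈ Finset.range (m + 1), (Y (m + 1) - Y (r + 1)) * f (a + r) (m - r - 1) =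
      ∑ r ∈ Finset.range m, (Y (m + 1) - Y (r + 1)) * f (a + r) (m - 1 - r) := by
    rw [Finset.sum_range_succ, sub_self, zero_mul, add_zero]
    refine Finset.sum_congr rfl fun r _ => ?_
    congr 2
    omega
  have h8 : ∀ r ∈ Finset.range (m + 1), (x (a + r) * (0 - f (a + r) (m + 1 - 1 - r)) +
      (∑ s ∈ Finset.range (a + r), x s) *
        (f (a + r - 1) (m + 1 - 1 - r) - f (a + r) (m + 1 - 1 - r)) +
      (∑ s ∈ Finset.Ico (a + r + 1) (a + (m + 1)), x s) *
        (f (a + r) (m + 1 - 1 - r - 1) - f (a + r) (m + 1 - 1 - r))) =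
      X * f (a + r - 1) (m - r) - (X + Y (m + 1)) * f (a + r) (m - r) +
        Y r * f (a + r - 1) (m - r) + (Y (m + 1) - Y (r + 1)) * f (a + r) (m - r - 1) := by
    intro r hr
    have := Finset.mem_range.1 hr
    rw [h1, h2 r (by omega), h4, Nat.add_sub_cancel]
    ring
  rw [Finset.sum_congr rfl h8, h3, mul_sub, h5, Finset.sum_add_distrib, Finset.sum_add_distrib,
    Finset.sum_sub_distrib, h6, h7, ← Finset.mul_sum, ← Finset.mul_sum]
  have h9 : ∑ r ∈ Finset.range m, Y (r + 1) * f (a + r) (m - 1 - r) +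
      ∑ r ∈ Finset.range m, (Y (m + 1) - Y (r + 1)) * f (a + r) (m - 1 - r) =
      Y (m + 1) * posSum f a m := by
    rw [posSum, ← Finset.sum_add_distrib, Finset.mul_sum]
    exact Finset.sum_congr rfl fun r _ => by ring
  have h10 : posSum f a (m + 1) = ∑ r ∈ Finset.range (m + 1), f (a + r) (m - r) := rfl
  rw [Nat.add_sub_cancel, h10]
  linear_combination h9

/-- The length of a step of the uniformised chains: the inverse of a bound on all total rates. -/
def System.step (M : System) : ℝ≥0 := (M.lamI + M.lamE + M.k * (M.muI + M.muE))⁻¹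

theorem System.step_pos (M : System) : 0 < M.step := by
  have := M.lamI_pos
  unfold System.step
  positivity

theorem System.step_mul_rate_le {M : System} {u v : ℝ≥0} (h : u + v ≤ M.k) :
    M.step * (M.lamI + M.lamE + M.muI * u + M.muE * v) ≤ 1 := by
  have hpos : 0 < M.lamI + M.lamE + M.k * (M.muI + M.muE) := by
    have := M.lamI_pos
    positivity
  have h1 : u ≤ M.k := le_trans le_self_add h
  have h2 : v ≤ M.k := le_trans le_add_self h
  rw [System.step, inv_mul_le_iff₀ hpos, mul_one]
  calc M.lamI + M.lamE + M.muI * u + M.muE * v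
      ≤ M.lamI + M.lamE + M.muI * M.k + M.muE * M.k := by gcongr
    _ = _ := by ring

namespace Policy
variable {M : System} (π : Policy M)

theorem tot_le (i j : ℕ) : π.totI i j + π.totE i j ≤ M.k := π.total_le i j

theorem rate_le (i j : ℕ) :
    M.step * (M.lamI + M.lamE + M.muI * π.totI i j + M.muE * π.totE i j) ≤ 1 :=
  System.step_mul_rate_le (π.tot_le i j)

theorem step_mul_outRate_numTrans (s : ℕ × ℕ) : M.step * outRate π.numTrans s ≤ 1 := by
  refine le_trans (le_of_eq ?_) (π.rate_le s.1 s.2)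
  simp [outRate, numTrans]
  ring_nf
  simp

theorem totI_split (b c j : ℕ) : π.totI (b + c + 1) j = π.inel (b + c + 1) j b +
    ∑ r ∈ Finset.range b, π.inel (b + c + 1) j r +
    ∑ r ∈ Finset.Ico (b + 1) (b + c + 1), π.inel (b + c + 1) j r := by
  rw [totI, ← Finset.sum_range_add_sum_Ico _ (show b + 1 ≤ b + c + 1 by omega),
    Finset.sum_range_succ]
  ring

theorem totE_split (i b c : ℕ) : π.totE i (b + c + 1) = π.el i (b + c + 1) b +
    ∑ r ∈ Finset.range b, π.el i (b + c + 1) r +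
    ∑ r ∈ Finset.Ico (b + 1) (b + c + 1), π.el i (b + c + 1) r := by
  rw [totE, ← Finset.sum_range_add_sum_Ico _ (show b + 1 ≤ b + c + 1 by omega),
    Finset.sum_range_succ]
  ring

theorem step_mul_outRate_tagTrans (x : Tagged) : M.step * outRate π.tagTrans x ≤ 1 := by
  cases x with
  | inel b c j =>
    refine le_trans (le_of_eq ?_) (π.rate_le (b + c + 1) j)
    rw [totI_split]
    simp only [outRate, tagTrans, List.map_cons, List.map_nil, List.sum_cons, List.sum_nil]
    ring
  | el i b c =>
    refine le_trans (le_of_eq ?_) (π.rate_le i (b + c + 1))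
    rw [totE_split]
    simp only [outRate, tagTrans, List.map_cons, List.map_nil, List.sum_cons, List.sum_nil]
    ring
  | done => simp [outRate, tagTrans]

/-- The probability that the tagged job is still present after `n` steps of the uniformised
chain. -/
def surv (n : ℕ) : Tagged → ℝ :=
  (unif π.tagTrans M.step ^ n) (({Tagged.done}ᶜ : Set Tagged).indicator fun _ => 1)

theorem surv_succ (n : ℕ) : π.surv (n + 1) = unif π.tagTrans M.step (π.surv n) := by
  rw [surv, pow_succ', Module.End.mul_apply, surv]

theorem surv_nonneg (n : ℕ) (x : Tagged) : 0 ≤ π.surv n x := by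
  exact unif_pow_nonneg π.step_mul_outRate_tagTrans
    (Set.indicator_nonneg fun _ _ => zero_le_one) n x

theorem surv_done (n : ℕ) : π.surv n .done = 0 := by
  induction n with
  | zero => simp [surv]
  | succ n ih => rw [surv_succ, unif_apply, ih]; simp [tagTrans]

/-- The mean response time from a tagged state is the sum of the survival probabilities. -/
theorem meanTimeFrom_eq (x : Tagged) :
    π.meanTimeFrom x = M.step * ∑' n, ENNReal.ofReal (π.surv n x) := by
  unfold meanTimeFrom responseTime surv
  refine lintegral_timeIn_eq_unif M.step_pos.ne' π.step_mul_outRate_tagTrans ?_ ?_ x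
  · have h : 0 < M.lamI := M.lamI_pos
    rintro (⟨b, c, j⟩ | ⟨i, b, c⟩ | _) hx
    · simp [outRate, tagTrans, h.ne']
    · simp [outRate, tagTrans, h.ne']
    · exact absurd rfl hx
  · intro y hy
    have : y = .done := by simpa using hy
    rw [this, tagTrans]

theorem surv_succ_inel (n b c j N : ℕ) (hN : b + c + 1 = N) :
    π.surv (n + 1) (.inel b c j) = π.surv n (.inel b c j) + M.step * (
      M.lamI * (π.surv n (.inel b (c + 1) j) - π.surv n (.inel b c j)) +
      M.lamE * (π.surv n (.inel b c (j + 1)) - π.surv n (.inel b c j)) +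
      M.muI * ((π.inel N j b : ℝ) * (0 - π.surv n (.inel b c j)) +
        (∑ r ∈ Finset.range b, (π.inel N j r : ℝ)) *
          (π.surv n (.inel (b - 1) c j) - π.surv n (.inel b c j)) +
        (∑ r ∈ Finset.Ico (b + 1) N, (π.inel N j r : ℝ)) *
          (π.surv n (.inel b (c - 1) j) - π.surv n (.inel b c j))) +
      M.muE * π.totE N j * (π.surv n (.inel b c (j - 1)) - π.surv n (.inel b c j))) := by
  subst hN
  rw [surv_succ, unif_apply]
  simp only [tagTrans, List.map_cons, List.map_nil, List.sum_cons, List.sum_nil, surv_done,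
    NNReal.coe_mul, NNReal.coe_sum]
  ring

theorem surv_succ_el (n i b c N : ℕ) (hN : b + c + 1 = N) :
    π.surv (n + 1) (.el i b c) = π.surv n (.el i b c) + M.step * (
      M.lamI * (π.surv n (.el (i + 1) b c) - π.surv n (.el i b c)) +
      M.lamE * (π.surv n (.el i b (c + 1)) - π.surv n (.el i b c)) +
      M.muE * ((π.el i N b : ℝ) * (0 - π.surv n (.el i b c)) +
        (∑ r ∈ Finset.range b, (π.el i N r : ℝ)) *
          (π.surv n (.el i (b - 1) c) - π.surv n (.el i b c)) +
        (∑ r ∈ Finset.Ico (b + 1) N, (π.el i N r : ℝ)) *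
          (π.surv n (.el i b (c - 1)) - π.surv n (.el i b c))) +
      M.muI * π.totI i N * (π.surv n (.el (i - 1) b c) - π.surv n (.el i b c))) := by
  subst hN
  rw [surv_succ, unif_apply]
  simp only [tagTrans, List.map_cons, List.map_nil, List.sum_cons, List.sum_nil, surv_done,
    NNReal.coe_mul, NNReal.coe_sum]
  ring

/-- The expected number of the `i` latest inelastic jobs that are still present after `n` steps,
when `a + i` inelastic and `j` elastic jobs are present initially. -/
def newInel (n a i j : ℕ) : ℝ := posSum (fun b c => π.surv n (.inel b c j)) a i

/-- The expected number of the `j` latest elastic jobs that are still present after `n` steps,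
when `i` inelastic and `b + j` elastic jobs are present initially. -/
def newEl (n i b j : ℕ) : ℝ := posSum (fun b c => π.surv n (.el i b c)) b j

theorem newInel_succ (n a i j : ℕ) :
    π.newInel (n + 1) a i j = π.newInel n a i j + M.step * (
      M.lamI * (π.newInel n a (i + 1) j - π.surv n (.inel (a + i) 0 j) - π.newInel n a i j) +
      M.lamE * (π.newInel n a i (j + 1) - π.newInel n a i j) +
      M.muI * ((∑ s ∈ Finset.range a, (π.inel (a + i) j s : ℝ)) *
          (π.newInel n (a - 1) i j - π.newInel n a i j) +
        (∑ s ∈ Finset.Ico a (a + i), (π.inel (a + i) j s : ℝ)) *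
          (π.newInel n a (i - 1) j - π.newInel n a i j)) +
      M.muE * π.totE (a + i) j * (π.newInel n a i (j - 1) - π.newInel n a i j)) := by
  unfold newInel
  rw [posSum_succ, ← sum_completion]
  simp only [posSum]
  rw [add_sub_cancel_right]
  simp only [← Finset.sum_sub_distrib, Finset.mul_sum, ← Finset.sum_add_distrib]
  refine Finset.sum_congr rfl fun r hr => ?_
  have := Finset.mem_range.1 hr
  rw [π.surv_succ_inel n (a + r) (i - 1 - r) j (a + i) (by omega)]

theorem newEl_succ (n i b j : ℕ) :
    π.newEl (n + 1) i b j = π.newEl n i b j + M.step * (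
      M.lamI * (π.newEl n (i + 1) b j - π.newEl n i b j) +
      M.lamE * (π.newEl n i b (j + 1) - π.surv n (.el i (b + j) 0) - π.newEl n i b j) +
      M.muE * ((∑ s ∈ Finset.range b, (π.el i (b + j) s : ℝ)) *
          (π.newEl n i (b - 1) j - π.newEl n i b j) +
        (∑ s ∈ Finset.Ico b (b + j), (π.el i (b + j) s : ℝ)) *
          (π.newEl n i b (j - 1) - π.newEl n i b j)) +
      M.muI * π.totI i (b + j) * (π.newEl n (i - 1) b j - π.newEl n i b j)) := by
  unfold newEl
  rw [posSum_succ, ← sum_completion]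
  simp only [posSum]
  rw [add_sub_cancel_right]
  simp only [← Finset.sum_sub_distrib, Finset.mul_sum, ← Finset.sum_add_distrib]
  refine Finset.sum_congr rfl fun r hr => ?_
  have := Finset.mem_range.1 hr
  rw [π.surv_succ_el n i (b + r) (j - 1 - r) (b + j) (by omega)]

/-- The expected number of arrivals in one step that are still present `n` steps later, when they
find the state `s`. -/
def arrivalSurv (n : ℕ) (s : ℕ × ℕ) : ℝ :=
  M.step * (M.lamI * π.surv n (.inel s.1 0 s.2) + M.lamE * π.surv n (.el s.1 s.2 0))

/-- The expected number of jobs present after `n` steps that arrived during these steps, when the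
initial state is `s`. -/
def arrivedJobs : ℕ → ℕ × ℕ → ℝ
  | 0, _ => 0
  | n + 1, s => π.arrivalSurv n s + unif π.numTrans M.step (arrivedJobs n) s

/-- The expected number of new jobs present after `n` steps, from the state `x = (a, i, b, j)`:
initially `a + i` inelastic and `b + j` elastic jobs are present; the earliest `a` and `b` of them
are declared old and the others new, as are all later arrivals. -/
def newJobs (n : ℕ) (x : ℕ × ℕ × ℕ × ℕ) : ℝ :=
  π.newInel n x.1 x.2.1 (x.2.2.1 + x.2.2.2) + π.newEl n (x.1 + x.2.1) x.2.2.1 x.2.2.2 +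
    π.arrivedJobs n (x.1 + x.2.1, x.2.2.1 + x.2.2.2)

theorem newJobs_zero (x : ℕ × ℕ × ℕ × ℕ) : π.newJobs 0 x = (x.2.1 : ℝ) + x.2.2.2 := by
  simp [newJobs, newInel, newEl, posSum, surv, arrivedJobs]

/-- The chain that counts old and new jobs separately. In the state `(a, i, b, j)` there are `a` old
and `i` new inelastic jobs, `b` old and `j` new elastic jobs; the old jobs are the earliest ones. -/
def oldNewTrans : ℕ × ℕ × ℕ × ℕ → List (ℝ≥0 × (ℕ × ℕ × ℕ × ℕ))
  | (a, i, b, j) =>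
    [(M.lamI, (a, i + 1, b, j)),
     (M.lamE, (a, i, b, j + 1)),
     (M.muI * ∑ s ∈ Finset.range a, π.inel (a + i) (b + j) s, (a - 1, i, b, j)),
     (M.muI * ∑ s ∈ Finset.Ico a (a + i), π.inel (a + i) (b + j) s, (a, i - 1, b, j)),
     (M.muE * ∑ s ∈ Finset.range b, π.el (a + i) (b + j) s, (a, i, b - 1, j)),
     (M.muE * ∑ s ∈ Finset.Ico b (b + j), π.el (a + i) (b + j) s, (a, i, b, j - 1))]

theorem unif_oldNewTrans (f : ℕ × ℕ × ℕ × ℕ → ℝ) (a i b j : ℕ) :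
    unif π.oldNewTrans M.step f (a, i, b, j) = f (a, i, b, j) + M.step * (
    M.lamI * (f (a, i + 1, b, j) - f (a, i, b, j)) +
    M.lamE * (f (a, i, b, j + 1) - f (a, i, b, j)) +
    M.muI * ((∑ s ∈ Finset.range a, (π.inel (a + i) (b + j) s : ℝ)) *
        (f (a - 1, i, b, j) - f (a, i, b, j)) +
      (∑ s ∈ Finset.Ico a (a + i), (π.inel (a + i) (b + j) s : ℝ)) *
        (f (a, i - 1, b, j) - f (a, i, b, j))) +
    M.muE * ((∑ s ∈ Finset.range b, (π.el (a + i) (b + j) s : ℝ)) *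
        (f (a, i, b - 1, j) - f (a, i, b, j)) +
      (∑ s ∈ Finset.Ico b (b + j), (π.el (a + i) (b + j) s : ℝ)) *
        (f (a, i, b, j - 1) - f (a, i, b, j)))) := by
  rw [unif_apply]
  simp only [oldNewTrans, List.map_cons, List.map_nil, List.sum_cons, List.sum_nil, NNReal.coe_mul,
    NNReal.coe_sum]
  ring

theorem step_mul_outRate_oldNewTrans (x : ℕ × ℕ × ℕ × ℕ) :
    M.step * outRate π.oldNewTrans x ≤ 1 := by
  obtain ⟨a, i, b, j⟩ := x
  refine le_trans (le_of_eq ?_) (π.rate_le (a + i) (b + j))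
  rw [totI, totE, ← Finset.sum_range_add_sum_Ico _ (Nat.le_add_right a i),
    ← Finset.sum_range_add_sum_Ico _ (Nat.le_add_right b j)]
  simp only [outRate, oldNewTrans, List.map_cons, List.map_nil, List.sum_cons, List.sum_nil]
  ring

theorem totI_eq_old_add_new (a i j : ℕ) : (π.totI (a + i) j : ℝ) =
    ∑ s ∈ Finset.range a, (π.inel (a + i) j s : ℝ) +
    ∑ s ∈ Finset.Ico a (a + i), (π.inel (a + i) j s : ℝ) := by
  rw [totI, NNReal.coe_sum, Finset.sum_range_add_sum_Ico _ (Nat.le_add_right a i)]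

theorem totE_eq_old_add_new (i b j : ℕ) : (π.totE i (b + j) : ℝ) =
    ∑ s ∈ Finset.range b, (π.el i (b + j) s : ℝ) +
    ∑ s ∈ Finset.Ico b (b + j), (π.el i (b + j) s : ℝ) := by
  rw [totE, NNReal.coe_sum, Finset.sum_range_add_sum_Ico _ (Nat.le_add_right b j)]

/-- If there are no old jobs (`a = 0`) then `a - 1 + i` and `a + i - 1` may differ, but the total
service of the old jobs vanishes. -/
theorem sum_range_mul_pred (x : ℕ → ℝ) (g : ℕ → ℝ) (a i : ℕ) :
    (∑ s ∈ Finset.range a, x s) * g (a - 1 + i) = (∑ s ∈ Finset.range a, x s) * g (a + i - 1) := by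
  rcases a with _ | a
  · simp
  · congr 2
    omega

theorem sum_Ico_mul_pred (x : ℕ → ℝ) (g : ℕ → ℝ) (a i : ℕ) :
    (∑ s ∈ Finset.Ico a (a + i), x s) * g (a + (i - 1)) =
      (∑ s ∈ Finset.Ico a (a + i), x s) * g (a + i - 1) := by
  rcases i with _ | i
  · simp
  · congr 2

theorem unif_numTrans (f : ℕ × ℕ → ℝ) (i j : ℕ) :
    unif π.numTrans M.step f (i, j) = f (i, j) + M.step * (
      M.lamI * (f (i + 1, j) - f (i, j)) + M.lamE * (f (i, j + 1) - f (i, j)) +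
      M.muI * π.totI i j * (f (i - 1, j) - f (i, j)) +
      M.muE * π.totE i j * (f (i, j - 1) - f (i, j))) := by
  rw [unif_apply]
  simp only [numTrans, List.map_cons, List.map_nil, List.sum_cons, List.sum_nil, NNReal.coe_mul]
  ring

/-- The number of new jobs evolves linearly: summing the evolution of each tagged job over the
new jobs gives the evolution of their number. -/
theorem newJobs_succ (n : ℕ) : π.newJobs (n + 1) = unif π.oldNewTrans M.step (π.newJobs n) := by
  funext ⟨a, i, b, j⟩
  rw [unif_oldNewTrans]
  simp only [newJobs, newInel_succ, newEl_succ, arrivedJobs, arrivalSurv, unif_numTrans]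
  have e1 := sum_range_mul_pred (fun s => (π.inel (a + i) (b + j) s : ℝ))
    (fun m => π.newEl n m b j + π.arrivedJobs n (m, b + j)) a i
  have e2 := sum_Ico_mul_pred (fun s => (π.inel (a + i) (b + j) s : ℝ))
    (fun m => π.newEl n m b j + π.arrivedJobs n (m, b + j)) a i
  have e3 := sum_range_mul_pred (fun s => (π.el (a + i) (b + j) s : ℝ))
    (fun m => π.newInel n a i m + π.arrivedJobs n (a + i, m)) b j
  have e4 := sum_Ico_mul_pred (fun s => (π.el (a + i) (b + j) s : ℝ))
    (fun m => π.newInel n a i m + π.arrivedJobs n (a + i, m)) b j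
  rw [π.totI_eq_old_add_new a i (b + j), π.totE_eq_old_add_new (a + i) b j]
  simp only [← add_assoc]
  linear_combination (-(M.step : ℝ) * M.muI) * (e1 + e2) - (M.step : ℝ) * M.muE * (e3 + e4)

theorem arrivalSurv_nonneg (n : ℕ) (s : ℕ × ℕ) : 0 ≤ π.arrivalSurv n s := by
  have h1 := π.surv_nonneg n (.inel s.1 0 s.2)
  have h2 := π.surv_nonneg n (.el s.1 s.2 0)
  unfold arrivalSurv
  positivity

theorem arrivedJobs_nonneg (n : ℕ) (s : ℕ × ℕ) : 0 ≤ π.arrivedJobs n s := by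
  induction n generalizing s with
  | zero => exact le_rfl
  | succ n ih =>
    exact add_nonneg (π.arrivalSurv_nonneg n s) (unif_nonneg π.step_mul_outRate_numTrans ih s)

theorem newJobs_all_old (n a b : ℕ) : π.newJobs n (a, 0, b, 0) = π.arrivedJobs n (a, b) := by
  simp [newJobs, newInel, newEl, posSum]

theorem newJobs_all_new (n i j : ℕ) : π.newJobs n (0, i, 0, j) =
    (unif π.numTrans M.step ^ n) (fun s => (s.1 : ℝ) + s.2) (i, j) := by
  induction n generalizing i j with
  | zero => simp [newJobs_zero]
  | succ n ih =>
    rw [newJobs_succ, pow_succ', Module.End.mul_apply, unif_numTrans, unif_oldNewTrans]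
    simp only [ih, zero_add, totI, totE, NNReal.coe_sum,
      Finset.range_eq_Ico]
    ring

/-- The arrived jobs are at most all jobs. -/
theorem arrivedJobs_le (n i j : ℕ) : π.arrivedJobs n (i, j) ≤
    (unif π.numTrans M.step ^ n) (fun s => (s.1 : ℝ) + s.2) (i, j) := by
  rw [← newJobs_all_new, newJobs, zero_add, zero_add, le_add_iff_nonneg_left]
  unfold newInel newEl posSum
  exact add_nonneg (Finset.sum_nonneg fun r _ => π.surv_nonneg n _)
    (Finset.sum_nonneg fun r _ => π.surv_nonneg n _)

variable {π} {p : PMF (ℕ × ℕ)}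

/-- In a steady state the mean number of arrived jobs after `n` steps is a sum over the steps at
which they arrived. -/
theorem tsum_mul_arrivedJobs (hp : π.IsSteadyState p) (n : ℕ) :
    ∑' s, p s * ENNReal.ofReal (π.arrivedJobs n s) =
      ∑ l ∈ Finset.range n, ∑' s, p s * ENNReal.ofReal (π.arrivalSurv l s) := by
  induction n with
  | zero => simp [arrivedJobs]
  | succ n ih =>
    have h0 : ∀ s, ENNReal.ofReal (π.arrivedJobs (n + 1) s) =
        ENNReal.ofReal (π.arrivalSurv n s) +
          ENNReal.ofReal (unif π.numTrans M.step (π.arrivedJobs n) s) := fun s =>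
      ENNReal.ofReal_add (π.arrivalSurv_nonneg n s)
        (unif_nonneg π.step_mul_outRate_numTrans (π.arrivedJobs_nonneg n) s)
    simp_rw [h0, mul_add]
    rw [ENNReal.tsum_add, IsBalanced.tsum_mul_unif π.step_mul_outRate_numTrans hp
      (π.arrivedJobs_nonneg n), ih, Finset.sum_range_succ, add_comm]

theorem tsum_mul_unif_pow (hp : π.IsSteadyState p) (n : ℕ) {f : ℕ × ℕ → ℝ} (hf : ∀ s, 0 ≤ f s) :
    ∑' s, p s * ENNReal.ofReal ((unif π.numTrans M.step ^ n) f s) =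
      ∑' s, p s * ENNReal.ofReal (f s) := by
  induction n with
  | zero => simp
  | succ n ih =>
    rw [pow_succ', Module.End.mul_apply, IsBalanced.tsum_mul_unif π.step_mul_outRate_numTrans hp
      (unif_pow_nonneg π.step_mul_outRate_numTrans hf n), ih]

variable (π) (p) in
/-- The total arrival rate times the mean response time is the limit, from a steady state, of the
mean number of jobs that have arrived since time zero and are still present. -/
theorem lam_mul_meanResponseTime :
    ((M.lamI + M.lamE : ℝ≥0) : ℝ≥0∞) * π.meanResponseTime p =
      ∑' l, ∑' s, p s * ENNReal.ofReal (π.arrivalSurv l s) := by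
  have hpos : M.lamI + M.lamE ≠ 0 := by
    have := M.lamI_pos
    positivity
  rw [meanResponseTime, ← ENNReal.tsum_mul_left, ENNReal.tsum_comm]
  refine tsum_congr fun s => ?_
  rw [ENNReal.tsum_mul_left]
  have h : ∀ l, ENNReal.ofReal (π.arrivalSurv l s) =
      M.step * (M.lamI * ENNReal.ofReal (π.surv l (.inel s.1 0 s.2)) +
        M.lamE * ENNReal.ofReal (π.surv l (.el s.1 s.2 0))) := by
    intro l
    have h1 := π.surv_nonneg l (.inel s.1 0 s.2)
    have h2 := π.surv_nonneg l (.el s.1 s.2 0)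
    rw [arrivalSurv, ENNReal.ofReal_mul M.step.coe_nonneg, ENNReal.ofReal_add (by positivity)
      (by positivity), ENNReal.ofReal_mul M.lamI.coe_nonneg, ENNReal.ofReal_mul M.lamE.coe_nonneg]
    simp only [ENNReal.ofReal_coe_nnreal]
  simp_rw [h, meanTimeFrom_eq]
  rw [ENNReal.tsum_mul_left, ENNReal.tsum_add, ENNReal.tsum_mul_left, ENNReal.tsum_mul_left]
  have h3 : ∀ x : ℝ≥0, ((M.lamI + M.lamE : ℝ≥0) : ℝ≥0∞) * ((x / (M.lamI + M.lamE) : ℝ≥0) : ℝ≥0∞)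
      = x := by
    intro x
    rw [← ENNReal.coe_mul, mul_div_cancel₀ _ hpos]
  generalize ∑' l, ENNReal.ofReal (π.surv l (.inel s.1 0 s.2)) = U
  generalize ∑' l, ENNReal.ofReal (π.surv l (.el s.1 s.2 0)) = V
  conv_rhs => rw [← h3 M.lamI, ← h3 M.lamE]
  ring

/-- One half of Little's law. The other half may fail: jobs that are never served count for the
number of jobs in system but not for the response times of arrivals. -/
theorem lam_mul_meanResponseTime_le (hp : π.IsSteadyState p) :
    ((M.lamI + M.lamE : ℝ≥0) : ℝ≥0∞) * π.meanResponseTime p ≤ meanNumber p := by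
  rw [lam_mul_meanResponseTime]
  refine ENNReal.tsum_le_of_sum_range_le fun n => ?_
  have hN : ∀ s : ℕ × ℕ, (0 : ℝ) ≤ (s.1 : ℝ) + s.2 := fun s => by positivity
  have h : ∑' s, p s * ENNReal.ofReal (π.arrivedJobs n s) ≤
      ∑' s, p s * ENNReal.ofReal ((unif π.numTrans M.step ^ n) (fun s => (s.1 : ℝ) + s.2) s) :=
    ENNReal.tsum_le_tsum fun s => by gcongr; exact π.arrivedJobs_le n s.1 s.2
  rw [tsum_mul_arrivedJobs hp, tsum_mul_unif_pow hp n hN] at h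
  refine h.trans (le_of_eq (tsum_congr fun s => ?_))
  rw [ENNReal.ofReal_add (by positivity) (by positivity), ENNReal.ofReal_natCast,
    ENNReal.ofReal_natCast]

end Policy

/-! ### The Bellman operator -/

namespace System
variable (M : System)

/-- The transitions out of `s` when `u` servers work on inelastic and `v` on elastic jobs. -/
def actTrans (u v : ℝ≥0) (s : ℕ × ℕ) : List (ℝ≥0 × (ℕ × ℕ)) :=
  [(M.lamI, (s.1 + 1, s.2)), (M.lamE, (s.1, s.2 + 1)), (M.muI * u, (s.1 - 1, s.2)),
   (M.muE * v, (s.1, s.2 - 1))]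

/-- The one-step operator of the uniformised chain under the allocation `(u, v)`. -/
def actOp (u v : ℝ≥0) : Module.End ℝ (ℕ × ℕ → ℝ) := unif (M.actTrans u v) M.step

theorem actOp_apply (u v : ℝ≥0) (f : ℕ × ℕ → ℝ) (i j : ℕ) : M.actOp u v f (i, j) =
    f (i, j) + M.step * (
      M.lamI * (f (i + 1, j) - f (i, j)) + M.lamE * (f (i, j + 1) - f (i, j)) +
      M.muI * u * (f (i - 1, j) - f (i, j)) + M.muE * v * (f (i, j - 1) - f (i, j))) := by
  rw [actOp, unif_apply]
  simp only [actTrans, List.map_cons, List.map_nil, List.sum_cons, List.sum_nil, NNReal.coe_mul]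
  ring

variable {M} in
theorem step_mul_outRate_actTrans {u v : ℝ≥0} (h : u + v ≤ M.k) (s : ℕ × ℕ) :
    M.step * outRate (M.actTrans u v) s ≤ 1 := by
  refine le_trans (le_of_eq ?_) (step_mul_rate_le h)
  simp only [outRate, actTrans, List.map_cons, List.map_nil, List.sum_cons, List.sum_nil]
  ring

/-- The numbers `u` and `v` of servers can be given to inelastic and elastic jobs in the
state `s`. -/
def Feasible (s : ℕ × ℕ) (u v : ℝ≥0) : Prop :=
  u ≤ s.1 ∧ u + v ≤ M.k ∧ (s.2 = 0 → v = 0)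

/-- Servers given to inelastic jobs by the two extreme work-conserving allocations: inelastic
first (`b = true`) and elastic first (`b = false`). -/
def allocI (b : Bool) (s : ℕ × ℕ) : ℝ≥0 :=
  if b = true ∨ s.2 = 0 then min (s.1 : ℝ≥0) (M.k : ℝ≥0) else 0

/-- Servers given to elastic jobs by the two extreme work-conserving allocations: all that are not
given to inelastic jobs. -/
def allocE (b : Bool) (s : ℕ × ℕ) : ℝ≥0 := if s.2 = 0 then 0 else M.k - M.allocI b s

theorem allocI_le_k (b : Bool) (s : ℕ × ℕ) : M.allocI b s ≤ M.k := by
  unfold allocI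
  split_ifs
  · exact min_le_right _ _
  · exact zero_le

theorem allocI_add_allocE_of_ne (b : Bool) {s : ℕ × ℕ} (h : s.2 ≠ 0) :
    M.allocI b s + M.allocE b s = M.k := by
  rw [allocE, if_neg h, add_tsub_cancel_of_le (M.allocI_le_k b s)]

theorem feasible_alloc (b : Bool) (s : ℕ × ℕ) : M.Feasible s (M.allocI b s) (M.allocE b s) := by
  refine ⟨?_, ?_, fun h => by simp [allocE, h]⟩
  · unfold allocI
    split_ifs
    · exact min_le_left _ _
    · exact zero_le
  · by_cases h : s.2 = 0
    · simpa [allocE, h] using M.allocI_le_k b s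
    · exact (M.allocI_add_allocE_of_ne b h).le

/-- The Bellman operator: the expectation of `f` after one step, minimised over the two extreme
work-conserving allocations. -/
def bellman (f : ℕ × ℕ → ℝ) (s : ℕ × ℕ) : ℝ :=
  min (M.actOp (M.allocI true s) (M.allocE true s) f s)
    (M.actOp (M.allocI false s) (M.allocE false s) f s)

theorem bellman_le_alloc (f : ℕ × ℕ → ℝ) (b : Bool) (s : ℕ × ℕ) :
    M.bellman f s ≤ M.actOp (M.allocI b s) (M.allocE b s) f s := by
  cases b
  · exact min_le_right _ _
  · exact min_le_left _ _

theorem exists_bellman_eq (f : ℕ × ℕ → ℝ) (s : ℕ × ℕ) :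
    ∃ b, M.bellman f s = M.actOp (M.allocI b s) (M.allocE b s) f s := by
  rcases min_choice (M.actOp (M.allocI true s) (M.allocE true s) f s)
    (M.actOp (M.allocI false s) (M.allocE false s) f s) with h | h
  · exact ⟨true, h⟩
  · exact ⟨false, h⟩

end System

/-- `f` does not decrease when a job is added. -/
def IsMono (f : ℕ × ℕ → ℝ) : Prop := ∀ i j, f (i, j) ≤ f (i + 1, j) ∧ f (i, j) ≤ f (i, j + 1)

theorem IsMono.pred_left {f : ℕ × ℕ → ℝ} (hf : IsMono f) (i j : ℕ) : f (i - 1, j) ≤ f (i, j) := by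
  rcases i with _ | i
  · exact le_rfl
  · exact (hf i j).1

theorem IsMono.pred_right {f : ℕ × ℕ → ℝ} (hf : IsMono f) (i j : ℕ) : f (i, j - 1) ≤ f (i, j) := by
  rcases j with _ | j
  · exact le_rfl
  · exact (hf i j).2

theorem IsMono.zero_le {f : ℕ × ℕ → ℝ} (hf : IsMono f) (s : ℕ × ℕ) : f (0, 0) ≤ f s := by
  obtain ⟨i, j⟩ := s
  induction i with
  | zero =>
    induction j with
    | zero => exact le_rfl
    | succ j ih => exact ih.trans (hf 0 j).2
  | succ i ih => exact ih.trans (hf i j).1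

namespace System
variable {M : System}

/-- For a monotone cost-to-go, one of the two extreme work-conserving allocations is optimal: the
expected cost is a linear function of `(u, v)` with nonpositive slopes. -/
theorem bellman_le {f : ℕ × ℕ → ℝ} (hf : IsMono f) {s : ℕ × ℕ} {u v : ℝ≥0}
    (h : M.Feasible s u v) : M.bellman f s ≤ M.actOp u v f s := by
  obtain ⟨i, j⟩ := s
  obtain ⟨h1, h2, h3⟩ := h
  have hu : (u : ℝ) ≤ i := by exact_mod_cast h1
  have huv : (u : ℝ) + v ≤ M.k := by exact_mod_cast h2
  have hu0 := u.coe_nonneg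
  have hv0 := v.coe_nonneg
  set A : ℝ := M.muI * (f (i, j) - f (i - 1, j)) with hA
  set B : ℝ := M.muE * (f (i, j) - f (i, j - 1)) with hB
  have hA0 : 0 ≤ A := mul_nonneg M.muI.coe_nonneg (sub_nonneg.2 (hf.pred_left i j))
  have hB0 : 0 ≤ B := mul_nonneg M.muE.coe_nonneg (sub_nonneg.2 (hf.pred_right i j))
  -- the objective is affine in the allocation, so only `u * A + v * B` has to be compared
  have key : ∀ u' v' : ℝ≥0, (u : ℝ) * A + v * B ≤ u' * A + v' * B →
      M.actOp u' v' f (i, j) ≤ M.actOp u v f (i, j) := by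
    intro u' v' hle
    rw [actOp_apply, actOp_apply]
    have := mul_le_mul_of_nonneg_left hle M.step.coe_nonneg
    simp only [hA, hB] at this
    nlinarith [this]
  have hmin : (u : ℝ) ≤ ((min (i : ℝ≥0) (M.k : ℝ≥0) : ℝ≥0) : ℝ) := by
    exact_mod_cast le_min h1 (le_trans le_self_add h2)
  rcases Nat.eq_zero_or_pos j with hj | hj
  · refine (M.bellman_le_alloc f true _).trans (key _ _ ?_)
    have hv : v = 0 := h3 hj
    simp only [allocI, true_or, if_true, hv, NNReal.coe_zero, zero_mul, add_zero]
    have := mul_le_mul_of_nonneg_right hmin hA0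
    have h4 : 0 ≤ (M.allocE true (i, j) : ℝ) * B := mul_nonneg (NNReal.coe_nonneg _) hB0
    linarith
  · have hsum : ∀ b, (M.allocI b (i, j) : ℝ) + M.allocE b (i, j) = M.k := fun b => by
      exact_mod_cast M.allocI_add_allocE_of_ne b (s := (i, j)) hj.ne'
    have hvB : (v : ℝ) * B ≤ (M.k - u) * B := mul_le_mul_of_nonneg_right (by linarith) hB0
    rcases le_total B A with hAB | hAB
    · refine (M.bellman_le_alloc f true _).trans (key _ _ ?_)
      have h5 : (M.allocE true (i, j) : ℝ) = M.k - M.allocI true (i, j) := by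
        linarith [hsum true]
      rw [h5]
      simp only [allocI, true_or, if_true]
      have := mul_le_mul_of_nonneg_right hmin (sub_nonneg.2 hAB)
      linarith
    · refine (M.bellman_le_alloc f false _).trans (key _ _ ?_)
      have h5 : M.allocI false (i, j) = 0 := by simp [allocI, hj.ne']
      have h6 := hsum false
      rw [h5] at h6 ⊢
      simp only [NNReal.coe_zero, zero_add] at h6
      rw [h6]
      have := mul_le_mul_of_nonneg_left hAB hu0
      simp only [NNReal.coe_zero]
      linarith

theorem bellman_mono {f g : ℕ × ℕ → ℝ} (h : ∀ s, f s ≤ g s) (s : ℕ × ℕ) :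
    M.bellman f s ≤ M.bellman g s :=
  min_le_min (unif_mono (step_mul_outRate_actTrans (M.feasible_alloc _ s).2.1) h s)
    (unif_mono (step_mul_outRate_actTrans (M.feasible_alloc _ s).2.1) h s)

theorem bellman_add_const (f : ℕ × ℕ → ℝ) (c : ℝ) (s : ℕ × ℕ) :
    M.bellman (fun y => f y + c) s = M.bellman f s + c := by
  have h : ∀ u v, M.actOp u v (fun y => f y + c) s = M.actOp u v f s + c := by
    intro u v
    rw [show (fun y => f y + c) = f + fun _ => c from rfl, map_add, Pi.add_apply, actOp, unif_const]
  rw [bellman, h, h, bellman, min_add_add_right]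

theorem bellman_nonneg {f : ℕ × ℕ → ℝ} (h : ∀ s, 0 ≤ f s) (s : ℕ × ℕ) : 0 ≤ M.bellman f s :=
  le_min (unif_nonneg (step_mul_outRate_actTrans (M.feasible_alloc _ s).2.1) h s)
    (unif_nonneg (step_mul_outRate_actTrans (M.feasible_alloc _ s).2.1) h s)

/-- Removing a job does not increase the optimal cost: with one job less, copy the allocation and
let the servers of the missing job idle. -/
theorem IsMono.bellman {f : ℕ × ℕ → ℝ} (hf : IsMono f) : IsMono (M.bellman f) := by
  intro i j
  constructor
  · obtain ⟨b, hb⟩ := M.exists_bellman_eq f (i + 1, j)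
    obtain ⟨h1, h2, h3⟩ := M.feasible_alloc b (i + 1, j)
    rw [hb]
    set u := M.allocI b (i + 1, j)
    set v := M.allocE b (i + 1, j)
    have hfe : M.Feasible (i, j) (min u i) v :=
      ⟨min_le_right _ _, le_trans (by gcongr; exact min_le_left _ _) h2, h3⟩
    refine (bellman_le hf hfe).trans ?_
    rw [actOp_apply, actOp_apply, Nat.add_sub_cancel]
    have hr : (M.step : ℝ) * (M.lamI + M.lamE + M.muI * u + M.muE * v) ≤ 1 := by
      exact_mod_cast step_mul_rate_le h2
    have e0 := mul_nonneg (sub_nonneg.2 hr) (sub_nonneg.2 (hf i j).1)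
    have e1 := mul_nonneg M.lamI.coe_nonneg (sub_nonneg.2 (hf (i + 1) j).1)
    have e2 := mul_nonneg M.lamE.coe_nonneg (sub_nonneg.2 (hf i (j + 1)).1)
    have e3 := mul_nonneg (M.muI * min u i : ℝ≥0).coe_nonneg (sub_nonneg.2 (hf.pred_left i j))
    have e4 := mul_nonneg (M.muE * v : ℝ≥0).coe_nonneg (sub_nonneg.2 (hf i (j - 1)).1)
    have e5 := mul_nonneg M.step.coe_nonneg (add_nonneg (add_nonneg (add_nonneg e1 e2) e3) e4)
    push_cast at e5 ⊢
    linarith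
  · obtain ⟨b, hb⟩ := M.exists_bellman_eq f (i, j + 1)
    obtain ⟨h1, h2, h3⟩ := M.feasible_alloc b (i, j + 1)
    rw [hb]
    set u := M.allocI b (i, j + 1)
    set v := M.allocE b (i, j + 1)
    set v' : ℝ≥0 := if j = 0 then 0 else v with hv'
    have hv'v : v' ≤ v := by
      rw [hv']
      split_ifs
      · exact zero_le
      · exact le_rfl
    have hfe : M.Feasible (i, j) u v' :=
      ⟨h1, le_trans (by gcongr) h2, fun h => by rw [hv', if_pos h]⟩
    refine (bellman_le hf hfe).trans ?_
    rw [actOp_apply, actOp_apply, Nat.add_sub_cancel]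
    have hr : (M.step : ℝ) * (M.lamI + M.lamE + M.muI * u + M.muE * v) ≤ 1 := by
      exact_mod_cast step_mul_rate_le h2
    have e0 := mul_nonneg (sub_nonneg.2 hr) (sub_nonneg.2 (hf i j).2)
    have e1 := mul_nonneg M.lamI.coe_nonneg (sub_nonneg.2 (hf (i + 1) j).2)
    have e2 := mul_nonneg M.lamE.coe_nonneg (sub_nonneg.2 (hf i (j + 1)).2)
    have e3 := mul_nonneg (M.muI * u : ℝ≥0).coe_nonneg (sub_nonneg.2 (hf (i - 1) j).2)
    have e4 := mul_nonneg (M.muE * v' : ℝ≥0).coe_nonneg (sub_nonneg.2 (hf.pred_right i j))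
    have e5 := mul_nonneg M.step.coe_nonneg (add_nonneg (add_nonneg (add_nonneg e1 e2) e3) e4)
    push_cast at e5 ⊢
    linarith

theorem tendsto_bellman {ι : Type*} {l : Filter ι} {F : ι → ℕ × ℕ → ℝ} {f : ℕ × ℕ → ℝ}
    (h : ∀ s, Tendsto (fun n => F n s) l (𝓝 (f s))) (s : ℕ × ℕ) :
    Tendsto (fun n => M.bellman (F n) s) l (𝓝 (M.bellman f s)) := by
  obtain ⟨i, j⟩ := s
  have hact : ∀ u v : ℝ≥0, Tendsto (fun n => M.actOp u v (F n) (i, j)) l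
      (𝓝 (M.actOp u v f (i, j))) := by
    intro u v
    simp only [actOp_apply]
    exact (h _).add (((((((h _).sub (h _)).const_mul _).add
      (((h _).sub (h _)).const_mul _)).add (((h _).sub (h _)).const_mul _)).add
      (((h _).sub (h _)).const_mul _)).const_mul _)
  exact (hact _ _).min (hact _ _)

/-! ### Discounted costs -/

/-- The number of jobs in the state `s`. -/
def jobs (s : ℕ × ℕ) : ℝ := (s.1 : ℝ) + s.2

theorem jobs_nonneg (s : ℕ × ℕ) : 0 ≤ jobs s := by
  unfold jobs
  positivity

variable (M) in
/-- The minimal expected `α`-discounted number of jobs over `n` steps. -/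
def valueIter (α : ℝ) : ℕ → ℕ × ℕ → ℝ
  | 0, _ => 0
  | n + 1, s => jobs s + α * M.bellman (valueIter α n) s

variable {α : ℝ}

theorem valueIter_nonneg (hα : 0 ≤ α) (n : ℕ) (s : ℕ × ℕ) : 0 ≤ M.valueIter α n s := by
  induction n generalizing s with
  | zero => exact le_rfl
  | succ n ih => exact add_nonneg (jobs_nonneg s) (mul_nonneg hα (bellman_nonneg ih s))

theorem valueIter_isMono (hα : 0 ≤ α) (n : ℕ) : IsMono (M.valueIter α n) := by
  induction n with
  | zero => exact fun i j => ⟨le_rfl, le_rfl⟩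
  | succ n ih =>
    intro i j
    have h := IsMono.bellman (M := M) ih i j
    have h1 := mul_le_mul_of_nonneg_left h.1 hα
    have h2 := mul_le_mul_of_nonneg_left h.2 hα
    simp only [valueIter, jobs]
    push_cast
    constructor <;> linarith

theorem valueIter_le_succ (hα : 0 ≤ α) (n : ℕ) (s : ℕ × ℕ) :
    M.valueIter α n s ≤ M.valueIter α (n + 1) s := by
  induction n generalizing s with
  | zero => exact valueIter_nonneg hα 1 s
  | succ n ih =>
    have := mul_le_mul_of_nonneg_left (bellman_mono (M := M) ih s) hα
    rw [valueIter, valueIter]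
    linarith

/-- Under the stability condition some quadratic Lyapunov function `W` of the mean workload
`i / μI + j / μE` has, inelastic jobs being served first, a drift at most `c` minus the number of
jobs. -/
theorem exists_lyapunov (hload : M.load < 1) : ∃ (W : ℕ × ℕ → ℝ) (c : ℝ), (∀ s, 0 ≤ W s) ∧
    W (0, 0) = 0 ∧ 0 ≤ c ∧ ∀ s, jobs s + M.bellman W s ≤ W s + c := by
  have hI : (0 : ℝ) < M.muI := M.muI_pos
  have hE : (0 : ℝ) < M.muE := M.muE_pos
  have hk : (0 : ℝ) < M.k := by exact_mod_cast M.k_pos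
  have hδ : (0 : ℝ) < M.step := M.step_pos
  have hlI := M.lamI.coe_nonneg
  have hlE := M.lamE.coe_nonneg
  set ρ : ℝ := M.lamI / M.muI + M.lamE / M.muE with hρ
  have hρk : ρ < M.k := by
    have h : (M.lamI : ℝ) / (M.k * M.muI) + M.lamE / (M.k * M.muE) < 1 := by
      exact_mod_cast hload
    have h2 : (M.lamI : ℝ) / (M.k * M.muI) + M.lamE / (M.k * M.muE) = ρ / M.k := by
      rw [hρ]
      field_simp
    rw [h2, div_lt_one hk] at h
    exact h
  have hρ0 : 0 ≤ ρ := by positivity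
  set x : ℕ × ℕ → ℝ := fun s => s.1 / M.muI + s.2 / M.muE with hx
  have hx0 : ∀ s, 0 ≤ x s := fun s => by positivity
  -- `C` makes the negative drift of `C * x ^ 2`, with all servers busy, cancel the number of jobs
  set C : ℝ := (M.muI + M.muE) / (2 * M.step * (M.k - ρ)) with hC
  have hkρ : 0 < M.k - ρ := sub_pos.2 hρk
  have hC0 : 0 ≤ C := by positivity
  have hCeq : M.step * C * (2 * (M.k - ρ)) = M.muI + M.muE := by
    rw [hC]
    field_simp
  -- a bound on the second-order terms of the drift
  set D : ℝ := M.lamI / M.muI ^ 2 + M.lamE / M.muE ^ 2 + M.k / M.muI + M.k / M.muE with hD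
  have hD0 : 0 ≤ D := by positivity
  have hjobs : ∀ s, jobs s ≤ (M.muI + M.muE) * x s := by
    intro s
    have e1 : (s.1 : ℝ) = M.muI * (s.1 / M.muI) := by field_simp
    have e2 : (s.2 : ℝ) = M.muE * (s.2 / M.muE) := by field_simp
    have e3 : (0 : ℝ) ≤ M.muI * (s.2 / M.muE) := by positivity
    have e4 : (0 : ℝ) ≤ M.muE * (s.1 / M.muI) := by positivity
    simp only [jobs, hx]
    rw [mul_add, add_mul, add_mul]
    linarith
  set W : ℕ × ℕ → ℝ := fun s => C * x s ^ 2 with hW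
  set c : ℝ := M.step * C * D + (M.muI + M.muE) * (M.k / M.muI) +
    M.step * C * (2 * (M.k / M.muI) * ρ) with hc
  refine ⟨W, c, fun s => by positivity, by simp [hW, hx], by positivity, ?_⟩
  rintro ⟨i, j⟩
  refine le_trans (add_le_add_right (M.bellman_le_alloc W true (i, j)) _) ?_
  obtain ⟨h1, h2, h3⟩ := M.feasible_alloc true (i, j)
  set u := M.allocI true (i, j) with hu
  set v := M.allocE true (i, j)
  have hu0 := u.coe_nonneg
  have hv0 := v.coe_nonneg
  have huk : (u : ℝ) ≤ M.k := by exact_mod_cast le_trans le_self_add h2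
  have hvk : (v : ℝ) ≤ M.k := by exact_mod_cast le_trans le_add_self h2
  have d1 : W (i + 1, j) - W (i, j) = C * (2 * x (i, j) / M.muI + 1 / M.muI ^ 2) := by
    simp only [hW, hx]
    push_cast
    field_simp
    ring
  have d2 : W (i, j + 1) - W (i, j) = C * (2 * x (i, j) / M.muE + 1 / M.muE ^ 2) := by
    simp only [hW, hx]
    push_cast
    field_simp
    ring
  have d3 : (u : ℝ) * (W (i - 1, j) - W (i, j)) =
      u * (C * (-2 * x (i, j) / M.muI + 1 / M.muI ^ 2)) := by
    rcases i with _ | i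
    · have : u = 0 := by simpa using h1
      simp [this]
    · simp only [hW, hx, Nat.add_sub_cancel]
      push_cast
      field_simp
      ring
  have d4 : (v : ℝ) * (W (i, j - 1) - W (i, j)) =
      v * (C * (-2 * x (i, j) / M.muE + 1 / M.muE ^ 2)) := by
    rcases j with _ | j
    · have : v = 0 := h3 rfl
      simp [this]
    · simp only [hW, hx, Nat.add_sub_cancel]
      push_cast
      field_simp
      ring
  have drift : M.actOp u v W (i, j) = W (i, j) + M.step * C * (2 * x (i, j) * (ρ - (u + v)) +
      (M.lamI / M.muI ^ 2 + M.lamE / M.muE ^ 2 + u / M.muI + v / M.muE)) := by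
    rw [actOp_apply, d1, d2, mul_assoc (M.muI : ℝ), mul_assoc (M.muE : ℝ), d3, d4, hρ]
    field_simp
    ring
  have hsec : M.lamI / M.muI ^ 2 + M.lamE / M.muE ^ 2 + u / M.muI + v / M.muE ≤ D := by
    rw [hD]
    gcongr
  have hsec' := mul_le_mul_of_nonneg_left hsec (mul_nonneg hδ.le hC0)
  rw [drift]
  have hjx := hjobs (i, j)
  have hxij := hx0 (i, j)
  by_cases hfull : (u : ℝ) + v = M.k
  · rw [hfull]
    have e1 : M.step * C * (2 * x (i, j) * (ρ - M.k)) = -((M.muI + M.muE) * x (i, j)) := by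
      rw [← hCeq]
      ring
    have e2 : 0 ≤ (M.muI + M.muE) * (M.k / M.muI : ℝ) + M.step * C * (2 * (M.k / M.muI) * ρ) := by
      positivity
    rw [mul_add, e1, hc]
    linarith
  · -- a server can idle only if there are no elastic and fewer than `k` inelastic jobs
    have hj : j = 0 := by
      by_contra hj
      exact hfull (by exact_mod_cast M.allocI_add_allocE_of_ne true (s := (i, j)) hj)
    have hik : (i : ℝ) ≤ M.k := by
      by_contra hik
      have hle : (M.k : ℝ≥0) ≤ i := by exact_mod_cast (not_le.1 hik).le
      have hu' : u = M.k := by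
        rw [hu, allocI, if_pos (Or.inl rfl)]
        exact min_eq_right hle
      have hv' : v = 0 := h3 hj
      exact hfull (by rw [hu', hv']; simp)
    have hxk : x (i, j) ≤ M.k / M.muI := by
      simp only [hx, hj]
      simp only [Nat.cast_zero, zero_div, add_zero]
      gcongr
    have e1 : 2 * x (i, j) * (ρ - (u + v)) ≤ 2 * (M.k / M.muI) * ρ := by
      have : 2 * x (i, j) * (ρ - (u + v)) ≤ 2 * x (i, j) * ρ := by
        gcongr
        linarith
      refine this.trans ?_
      gcongr
    have e2 := mul_le_mul_of_nonneg_left e1 (mul_nonneg hδ.le hC0)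
    have e3 : jobs (i, j) ≤ (M.muI + M.muE) * (M.k / M.muI) := hjx.trans (by gcongr)
    rw [mul_add, hc]
    linarith

theorem valueIter_le {W : ℕ × ℕ → ℝ} {c : ℝ} (hW : ∀ s, 0 ≤ W s) (hc : 0 ≤ c)
    (hd : ∀ s, jobs s + M.bellman W s ≤ W s + c) (hα : 0 ≤ α) (hα1 : α < 1) (n : ℕ) (s : ℕ × ℕ) :
    M.valueIter α n s ≤ W s + c / (1 - α) := by
  have h1 : 0 < 1 - α := sub_pos.2 hα1
  induction n generalizing s with
  | zero => exact add_nonneg (hW s) (by positivity)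
  | succ n ih =>
    have h2 := bellman_mono (M := M) ih s
    rw [bellman_add_const] at h2
    have h3 := mul_le_mul_of_nonneg_left h2 hα
    have h4 : α * M.bellman W s ≤ 1 * M.bellman W s :=
      mul_le_mul_of_nonneg_right hα1.le (bellman_nonneg hW s)
    have h5 : α * (c / (1 - α)) + c = c / (1 - α) := by
      field_simp
      ring
    have := hd s
    rw [valueIter]
    linarith

variable (M) in
/-- The minimal expected `α`-discounted number of jobs over an infinite horizon. -/
def value (α : ℝ) (s : ℕ × ℕ) : ℝ := ⨆ n, M.valueIter α n s

/-- A fixed point of the average-cost problem: `h` is a relative value function and `g` the minimal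
average number of jobs. They are limits of relative discounted values
`V s - V 0` and of `(1 - α) * V 0` as `α → 1`. -/
theorem exists_averageCost (hload : M.load < 1) : ∃ (g : ℝ) (h : ℕ × ℕ → ℝ), IsMono h ∧
    h (0, 0) = 0 ∧ (∀ s, h s + g = jobs s + M.bellman h s) ∧
    ∀ B : ℝ, (∀ α : ℝ, 0 ≤ α → α < 1 → ∀ n, (1 - α) * M.valueIter α n (0, 0) ≤ B) → g ≤ B := by
  obtain ⟨W, c, hW, hW0, hc, hd⟩ := M.exists_lyapunov hload
  set V := M.value with hV
  have hbdd : ∀ α, 0 ≤ α → α < 1 → ∀ s, BddAbove (Set.range fun n => M.valueIter α n s) := by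
    rintro α h0 h1 s
    refine ⟨W s + c / (1 - α), ?_⟩
    rintro _ ⟨n, rfl⟩
    exact valueIter_le hW hc hd h0 h1 n s
  have hlim : ∀ α, 0 ≤ α → α < 1 → ∀ s,
      Tendsto (fun n => M.valueIter α n s) atTop (𝓝 (V α s)) := fun α h0 h1 s =>
    tendsto_atTop_ciSup (monotone_nat_of_le_succ fun n => valueIter_le_succ h0 n s) (hbdd α h0 h1 s)
  have hmono : ∀ α, 0 ≤ α → α < 1 → IsMono (V α) := fun α h0 h1 i j =>
    ⟨le_of_tendsto_of_tendsto' (hlim α h0 h1 _) (hlim α h0 h1 _)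
        fun n => (valueIter_isMono h0 n i j).1,
      le_of_tendsto_of_tendsto' (hlim α h0 h1 _) (hlim α h0 h1 _)
        fun n => (valueIter_isMono h0 n i j).2⟩
  have hfix : ∀ α, 0 ≤ α → α < 1 → ∀ s, V α s = jobs s + α * M.bellman (V α) s := by
    intro α h0 h1 s
    refine tendsto_nhds_unique ((tendsto_add_atTop_iff_nat 1).2 (hlim α h0 h1 s)) ?_
    exact ((tendsto_bellman (hlim α h0 h1) s).const_mul α).const_add _
  have hV0 : ∀ α, 0 ≤ α → α < 1 → 0 ≤ V α (0, 0) := fun α h0 h1 =>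
    ge_of_tendsto' (hlim α h0 h1 _) fun n => valueIter_nonneg h0 n _
  have hVc : ∀ α, 0 ≤ α → α < 1 → (1 - α) * V α (0, 0) ≤ c := by
    intro α h0 h1
    have h2 : V α (0, 0) ≤ c / (1 - α) := by
      refine le_of_tendsto' (hlim α h0 h1 _) fun n => ?_
      have := valueIter_le (M := M) hW hc hd h0 h1 n (0, 0)
      rwa [hW0, zero_add] at this
    rwa [le_div_iff₀ (sub_pos.2 h1), mul_comm] at h2
  set h : ℝ → ℕ × ℕ → ℝ := fun α s => V α s - V α (0, 0) with hh
  have hh0 : ∀ α, 0 ≤ α → α < 1 → ∀ s, 0 ≤ h α s := fun α h0 h1 s =>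
    sub_nonneg.2 ((hmono α h0 h1).zero_le s)
  have hhfix : ∀ α, 0 ≤ α → α < 1 → ∀ s,
      h α s + (1 - α) * V α (0, 0) = jobs s + α * M.bellman (h α) s := by
    intro α h0 h1 s
    have e : h α = fun y => V α y + -V α (0, 0) := rfl
    rw [e, bellman_add_const]
    have := hfix α h0 h1 s
    linear_combination this
  -- A state reached by an arrival has a bounded relative value: the relative values are
  -- nonnegative, so the fixed-point equation bounds each of its terms.
  have hstep : ∀ α, 1 / 2 ≤ α → α < 1 → ∀ i j,
      M.step * M.lamI * h α (i + 1, j) ≤ 2 * (h α (i, j) + c) ∧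
      M.step * M.lamE * h α (i, j + 1) ≤ 2 * (h α (i, j) + c) := by
    intro α h2 h1 i j
    have h0 : 0 ≤ α := by linarith
    obtain ⟨b, hb⟩ := M.exists_bellman_eq (h α) (i, j)
    have hr : (M.step : ℝ) * (M.lamI + M.lamE + M.muI * M.allocI b (i, j) +
        M.muE * M.allocE b (i, j)) ≤ 1 := by
      exact_mod_cast step_mul_rate_le (M.feasible_alloc b (i, j)).2.1
    have e0 := mul_nonneg (sub_nonneg.2 hr) (hh0 α h0 h1 (i, j))
    have e1 := mul_nonneg (M.step * M.lamI).coe_nonneg (hh0 α h0 h1 (i + 1, j))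
    have e2 := mul_nonneg (M.step * M.lamE).coe_nonneg (hh0 α h0 h1 (i, j + 1))
    have e3 := mul_nonneg (M.step * (M.muI * M.allocI b (i, j))).coe_nonneg
      (hh0 α h0 h1 (i - 1, j))
    have e4 := mul_nonneg (M.step * (M.muE * M.allocE b (i, j))).coe_nonneg
      (hh0 α h0 h1 (i, j - 1))
    have e5 := hhfix α h0 h1 (i, j)
    have e6 := hVc α h0 h1
    have e7 := jobs_nonneg (i, j)
    push_cast at e1 e2 e3 e4
    have e8 : M.step * M.lamI * h α (i + 1, j) + M.step * M.lamE * h α (i, j + 1) ≤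
        M.bellman (h α) (i, j) := by
      rw [hb, actOp_apply]
      linarith
    have e9 : 0 ≤ M.bellman (h α) (i, j) := by linarith
    have e10 : (1 / 2) * M.bellman (h α) (i, j) ≤ α * M.bellman (h α) (i, j) :=
      mul_le_mul_of_nonneg_right h2 e9
    constructor <;> linarith
  have hbound : ∀ s, ∃ H : ℝ, ∀ α, 1 / 2 ≤ α → α < 1 → h α s ≤ H := by
    have hδI : (0 : ℝ) < M.step * M.lamI := by exact_mod_cast mul_pos M.step_pos M.lamI_pos
    have hδE : (0 : ℝ) < M.step * M.lamE := by exact_mod_cast mul_pos M.step_pos M.lamE_pos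
    rintro ⟨i, j⟩
    induction i with
    | zero =>
      induction j with
      | zero => exact ⟨0, fun α _ _ => by simp [hh]⟩
      | succ j ih =>
        obtain ⟨H, hH⟩ := ih
        refine ⟨2 * (H + c) / (M.step * M.lamE), fun α h2 h1 => ?_⟩
        rw [le_div_iff₀' hδE]
        linarith [(hstep α h2 h1 0 j).2, hH α h2 h1]
    | succ i ih =>
      obtain ⟨H, hH⟩ := ih
      refine ⟨2 * (H + c) / (M.step * M.lamI), fun α h2 h1 => ?_⟩
      rw [le_div_iff₀' hδI]
      linarith [(hstep α h2 h1 i j).1, hH α h2 h1]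
  -- an ultrafilter makes all the bounded families converge as `α → 1`
  obtain ⟨U, hU⟩ : ∃ U : Ultrafilter ℝ, (U : Filter ℝ) ≤ 𝓝[<] (1 : ℝ) :=
    Ultrafilter.exists_le _
  have hUα : ∀ᶠ α in (U : Filter ℝ), 1 / 2 ≤ α ∧ α < 1 :=
    hU (by
      have : Set.Ico (1 / 2 : ℝ) 1 ∈ 𝓝[<] (1 : ℝ) := Ico_mem_nhdsLT (by norm_num)
      exact this)
  have hU1 : Tendsto (fun α : ℝ => α) U (𝓝 1) := tendsto_id.mono_left (hU.trans nhdsWithin_le_nhds)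
  have hconv : ∀ (F : ℝ → ℝ) (a b : ℝ), (∀ α, 1 / 2 ≤ α → α < 1 → a ≤ F α ∧ F α ≤ b) →
      ∃ l, Tendsto F U (𝓝 l) := by
    intro F a b hF
    obtain ⟨l, -, hl⟩ := (isCompact_Icc (a := a) (b := b)).ultrafilter_le_nhds (U.map F) (by
      rw [le_principal_iff, Ultrafilter.mem_coe, Ultrafilter.mem_map]
      filter_upwards [hUα] with α hα
      exact hF α hα.1 hα.2)
    exact ⟨l, hl⟩
  obtain ⟨g, hg⟩ := hconv (fun α => (1 - α) * V α (0, 0)) 0 c fun α h2 h1 =>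
    ⟨mul_nonneg (sub_nonneg.2 h1.le) (hV0 α (by linarith) h1), hVc α (by linarith) h1⟩
  have hex : ∀ s, ∃ l, Tendsto (fun α => h α s) U (𝓝 l) := by
    intro s
    obtain ⟨H, hH⟩ := hbound s
    exact hconv _ 0 H fun α h2 h1 => ⟨hh0 α (by linarith) h1 s, hH α h2 h1⟩
  choose h' hh' using hex
  refine ⟨g, h', fun i j => ⟨?_, ?_⟩, ?_, fun s => ?_, fun B hB => ?_⟩
  · refine le_of_tendsto_of_tendsto (hh' (i, j)) (hh' (i + 1, j)) ?_
    filter_upwards [hUα] with α hα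
    exact sub_le_sub_right (hmono α (by linarith [hα.1]) hα.2 i j).1 _
  · refine le_of_tendsto_of_tendsto (hh' (i, j)) (hh' (i, j + 1)) ?_
    filter_upwards [hUα] with α hα
    exact sub_le_sub_right (hmono α (by linarith [hα.1]) hα.2 i j).2 _
  · refine tendsto_nhds_unique (hh' (0, 0)) ?_
    simp only [hh, sub_self]
    exact tendsto_const_nhds
  · refine tendsto_nhds_unique ((hh' s).add hg) ?_
    have h1 := (hU1.mul (tendsto_bellman (M := M) hh' s)).const_add (jobs s)
    rw [one_mul] at h1
    refine h1.congr' ?_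
    filter_upwards [hUα] with α hα
    exact (hhfix α (by linarith [hα.1]) hα.2 s).symm
  · refine le_of_tendsto hg ?_
    filter_upwards [hUα] with α hα
    have h0 : 0 ≤ α := by linarith [hα.1]
    exact le_of_tendsto' ((hlim α h0 hα.2 (0, 0)).const_mul (1 - α)) fun n => hB α h0 hα.2 n

end System

/-! ### The lower bound for arbitrary policies -/

namespace Policy
open _root_.ElasticQueue.System
variable {M : System} (π : Policy M)

/-- The service of the new jobs alone is a feasible allocation in a system of the new jobs. -/
theorem feasible_new (a i b j : ℕ) :
    M.Feasible (i, j) (∑ s ∈ Finset.Ico a (a + i), π.inel (a + i) (b + j) s)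
      (∑ s ∈ Finset.Ico b (b + j), π.el (a + i) (b + j) s) := by
  refine ⟨?_, ?_, fun h => ?_⟩
  · refine (Finset.sum_le_card_nsmul _ _ 1 fun s hs => ?_).trans (by simp)
    exact π.inel_le_one _ _ _ (Finset.mem_Ico.1 hs).2
  · refine le_trans (add_le_add ?_ ?_) (π.tot_le (a + i) (b + j))
    · rw [totI, ← Finset.sum_range_add_sum_Ico _ (Nat.le_add_right a i)]
      exact le_add_self
    · rw [totE, ← Finset.sum_range_add_sum_Ico _ (Nat.le_add_right b j)]
      exact le_add_self
  · have h' : j = 0 := h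
    subst h'
    simp

/-- Whatever a policy does for the old jobs, the service of the new jobs is itself a feasible
allocation, so the discounted number of new jobs is at least the optimal one. -/
theorem valueIter_le_newJobs {α : ℝ} (hα : 0 ≤ α) (n : ℕ) (x : ℕ × ℕ × ℕ × ℕ) :
    M.valueIter α n (x.2.1, x.2.2.2) ≤ ∑ l ∈ Finset.range n, α ^ l * π.newJobs l x := by
  induction n generalizing x with
  | zero => simp [valueIter]
  | succ n ih =>
    obtain ⟨a, i, b, j⟩ := x
    have h1 := bellman_le (M := M) (valueIter_isMono (M := M) hα n) (π.feasible_new a i b j)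
    have h2 : M.actOp (∑ s ∈ Finset.Ico a (a + i), π.inel (a + i) (b + j) s)
        (∑ s ∈ Finset.Ico b (b + j), π.el (a + i) (b + j) s) (M.valueIter α n) (i, j) =
        unif π.oldNewTrans M.step (fun x => M.valueIter α n (x.2.1, x.2.2.2)) (a, i, b, j) := by
      rw [actOp_apply, unif_oldNewTrans]
      simp only [NNReal.coe_sum]
      ring
    have h3 := unif_mono π.step_mul_outRate_oldNewTrans ih (a, i, b, j)
    have h4 : (fun x => ∑ l ∈ Finset.range n, α ^ l * π.newJobs l x) =
        ∑ l ∈ Finset.range n, α ^ l • π.newJobs l := by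
      funext x
      simp
    rw [h4, map_sum] at h3
    have h5 := mul_le_mul_of_nonneg_left (h1.trans (h2.le.trans h3)) hα
    rw [Finset.sum_range_succ', newJobs_zero, pow_zero, one_mul, valueIter, add_comm (jobs _)]
    refine add_le_add (h5.trans (le_of_eq ?_)) le_rfl
    rw [Finset.sum_apply, Finset.mul_sum]
    refine Finset.sum_congr rfl fun l _ => ?_
    rw [map_smul, Pi.smul_apply, smul_eq_mul, ← newJobs_succ]
    ring

variable {π} {p : PMF (ℕ × ℕ)}

/-- The number of arrived jobs from a steady state is at most `λ E[T]`, where `λ` is the total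
arrival rate, and its discounted sum is at least the optimal one, which gives the normalised bound.
-/
theorem discounted_le_meanResponseTime (hp : π.IsSteadyState p) (hT : π.meanResponseTime p ≠ ⊤)
    {α : ℝ} (h0 : 0 ≤ α) (h1 : α < 1) (n : ℕ) : (1 - α) * M.valueIter α n (0, 0) ≤
      (((M.lamI + M.lamE : ℝ≥0) : ℝ≥0∞) * π.meanResponseTime p).toReal := by
  set B := ((M.lamI + M.lamE : ℝ≥0) : ℝ≥0∞) * π.meanResponseTime p with hB
  have hBtop : B ≠ ⊤ := ENNReal.mul_ne_top ENNReal.coe_ne_top hT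
  have harr : ∀ l, ∑' s, p s * ENNReal.ofReal (π.arrivedJobs l s) ≤ B := by
    intro l
    rw [tsum_mul_arrivedJobs hp, hB, lam_mul_meanResponseTime]
    exact ENNReal.sum_le_tsum _
  have hV : ∀ s, M.valueIter α n (0, 0) ≤ ∑ l ∈ Finset.range n, α ^ l * π.arrivedJobs l s := by
    intro s
    have := π.valueIter_le_newJobs h0 n (s.1, 0, s.2, 0)
    simpa only [newJobs_all_old] using this
  have h2 : ENNReal.ofReal (M.valueIter α n (0, 0)) ≤
      ∑ l ∈ Finset.range n, ENNReal.ofReal (α ^ l) * B := by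
    calc ENNReal.ofReal (M.valueIter α n (0, 0))
        = ∑' s, p s * ENNReal.ofReal (M.valueIter α n (0, 0)) := by
          rw [ENNReal.tsum_mul_right, p.tsum_coe, one_mul]
      _ ≤ ∑' s, p s * ∑ l ∈ Finset.range n,
            ENNReal.ofReal (α ^ l) * ENNReal.ofReal (π.arrivedJobs l s) := by
          refine ENNReal.tsum_le_tsum fun s => ?_
          gcongr
          refine (ENNReal.ofReal_le_ofReal (hV s)).trans (le_of_eq ?_)
          rw [ENNReal.ofReal_sum_of_nonneg fun l _ =>
            mul_nonneg (pow_nonneg h0 l) (π.arrivedJobs_nonneg l s)]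
          exact Finset.sum_congr rfl fun l _ => ENNReal.ofReal_mul (pow_nonneg h0 l)
      _ = ∑ l ∈ Finset.range n,
            ENNReal.ofReal (α ^ l) * ∑' s, p s * ENNReal.ofReal (π.arrivedJobs l s) := by
          simp_rw [Finset.mul_sum]
          rw [Summable.tsum_finsetSum fun _ _ => ENNReal.summable]
          refine Finset.sum_congr rfl fun l _ => ?_
          rw [← ENNReal.tsum_mul_left]
          exact tsum_congr fun s => by ring
      _ ≤ _ := by
          gcongr with l
          exact harr l
  rw [← Finset.sum_mul, ← ENNReal.ofReal_sum_of_nonneg fun l _ => pow_nonneg h0 l] at h2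
  have h3 := ENNReal.toReal_mono (ENNReal.mul_ne_top ENNReal.ofReal_ne_top hBtop) h2
  rw [ENNReal.toReal_ofReal (valueIter_nonneg h0 n _), ENNReal.toReal_mul,
    ENNReal.toReal_ofReal (Finset.sum_nonneg fun l _ => pow_nonneg h0 l)] at h3
  have h4 : (1 - α) * ∑ l ∈ Finset.range n, α ^ l ≤ 1 := by
    rw [mul_neg_geom_sum]
    linarith [pow_nonneg h0 n]
  calc (1 - α) * M.valueIter α n (0, 0)
      ≤ (1 - α) * ((∑ l ∈ Finset.range n, α ^ l) * B.toReal) :=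
        mul_le_mul_of_nonneg_left h3 (sub_nonneg.2 h1.le)
    _ = ((1 - α) * ∑ l ∈ Finset.range n, α ^ l) * B.toReal := by ring
    _ ≤ 1 * B.toReal := mul_le_mul_of_nonneg_right h4 ENNReal.toReal_nonneg
    _ = B.toReal := one_mul _

/-- A bound on all normalised optimal discounted costs bounds the mean number of arrived jobs in
system under every policy, hence, by Little's law, its mean response time. -/
theorem ofReal_le_lam_mul_meanResponseTime {g : ℝ}
    (hg : ∀ B : ℝ, (∀ α : ℝ, 0 ≤ α → α < 1 → ∀ n, (1 - α) * M.valueIter α n (0, 0) ≤ B) → g ≤ B)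
    (hp : π.IsSteadyState p) :
    ENNReal.ofReal g ≤ ((M.lamI + M.lamE : ℝ≥0) : ℝ≥0∞) * π.meanResponseTime p := by
  rcases eq_or_ne (π.meanResponseTime p) ⊤ with hT | hT
  · have hpos : ((M.lamI + M.lamE : ℝ≥0) : ℝ≥0∞) ≠ 0 := by
      have := M.lamI_pos
      exact_mod_cast (by positivity : M.lamI + M.lamE ≠ 0)
    rw [hT, ENNReal.mul_top hpos]
    exact le_top
  · exact ENNReal.ofReal_le_of_le_toReal
      (hg _ fun α h0 h1 n => discounted_le_meanResponseTime hp hT h0 h1 n)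

end Policy

/-! ### The greedy policy -/

theorem sum_range_min_one_tsub (u : ℝ≥0) (i : ℕ) :
    ∑ r ∈ Finset.range i, min 1 (u - r) = min u i := by
  induction i with
  | zero => simp
  | succ i ih =>
    rw [Finset.sum_range_succ, ih]
    push_cast
    rcases le_total u i with h | h
    · rw [min_eq_left h, tsub_eq_zero_of_le h, min_eq_left (h.trans le_self_add)]
      simp
    · rw [min_eq_right h]
      obtain ⟨d, rfl⟩ := exists_add_of_le h
      rw [add_tsub_cancel_left, min_comm 1, min_add_add_left]

/-- The policy that uses the extreme allocation `act s` in the state `s`, serves inelastic jobs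
first-come-first-serve and gives all servers of the elastic class to its first job. -/
def greedy (M : System) (act : ℕ × ℕ → Bool) : Policy M where
  inel i j r := min 1 (M.allocI (act (i, j)) (i, j) - r)
  el i j r := if r = 0 then M.allocE (act (i, j)) (i, j) else 0
  inel_le_one _ _ _ _ := min_le_left _ _
  total_le i j := by
    rw [sum_range_min_one_tsub]
    refine le_trans (add_le_add (min_le_left _ _) ?_) (M.feasible_alloc (act (i, j)) (i, j)).2.1
    rw [Finset.sum_ite_eq']
    split_ifs
    · exact le_rfl
    · exact zero_le

variable {M : System}

theorem totI_greedy (act : ℕ × ℕ → Bool) (i j : ℕ) :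
    (greedy M act).totI i j = M.allocI (act (i, j)) (i, j) := by
  rw [Policy.totI]
  simp only [greedy, sum_range_min_one_tsub]
  exact min_eq_left (M.feasible_alloc (act (i, j)) (i, j)).1

theorem totE_greedy (act : ℕ × ℕ → Bool) (i j : ℕ) :
    (greedy M act).totE i j = M.allocE (act (i, j)) (i, j) := by
  rw [Policy.totE]
  simp only [greedy]
  rw [Finset.sum_ite_eq']
  split_ifs with h
  · rfl
  · exact ((M.feasible_alloc (act (i, j)) (i, j)).2.2 (by simpa using h)).symm

theorem greedy_mem_classP (act : ℕ × ℕ → Bool) : greedy M act ∈ classP M := by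
  constructor
  · intro i j
    rw [totI_greedy, totE_greedy]
    rcases Nat.eq_zero_or_pos j with hj | hj
    · refine ⟨?_, fun h => absurd hj h.ne'⟩
      subst hj
      simp [System.allocI]
    · have h := M.allocI_add_allocE_of_ne (act (i, j)) (s := (i, j)) hj.ne'
      exact ⟨h ▸ min_le_right _ _, fun _ => h⟩
  · intro i j r _
    rw [totI_greedy]
    simp only [greedy]
    constructor
    · intro h
      have h1 : ((r + 1 : ℕ) : ℝ≥0) ≤ M.allocI (act (i, j)) (i, j) := (Nat.le_floor_iff zero_le).1 h
      push_cast at h1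
      exact min_eq_left (le_tsub_of_add_le_left h1)
    · intro h
      have h1 := (Nat.floor_lt (zero_le (a := M.allocI (act (i, j)) (i, j)))).1 h
      rw [tsub_eq_zero_of_le h1.le]
      simp

theorem unif_greedy (act : ℕ × ℕ → Bool) (f : ℕ × ℕ → ℝ) (s : ℕ × ℕ) :
    unif (greedy M act).numTrans M.step f s =
      M.actOp (M.allocI (act s) s) (M.allocE (act s) s) f s := by
  obtain ⟨i, j⟩ := s
  rw [Policy.unif_numTrans, System.actOp_apply, totI_greedy, totE_greedy]

/-! ### Irreducibility -/

theorem rate_ne_zero {S : Type} {t : S → List (ℝ≥0 × S)} {x : S} {w : ℝ≥0 × S} (hw : w ∈ t x)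
    (h : w.1 ≠ 0) : rate t x w.2 ≠ 0 := by
  classical
  intro h0
  rw [rate, List.sum_eq_zero_iff] at h0
  refine h (h0 _ (List.mem_map.2 ⟨w, hw, ?_⟩))
  simp

theorem IsBalanced.ne_zero_of_mem {S : Type} {t : S → List (ℝ≥0 × S)} {r : S → ℝ≥0∞}
    (hr : IsBalanced t r) {x : S} (hx : r x ≠ 0) {w : ℝ≥0 × S} (hw : w ∈ t x) (h : w.1 ≠ 0) :
    r w.2 ≠ 0 := by
  intro h0
  have h1 := hr w.2
  rw [h0, zero_mul, ENNReal.tsum_eq_zero] at h1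
  rcases mul_eq_zero.1 (h1 x) with h2 | h2
  · exact hx h2
  · exact rate_ne_zero hw h (by exact_mod_cast h2)

/-- Under a work-conserving policy every nonempty state has a departure, so the empty state is
reached from everywhere, and by arrivals every state is reached from the empty one. -/
theorem Policy.WorkConserving.irreducible {π : Policy M} (hπ : π.WorkConserving)
    {r : ℕ × ℕ → ℝ≥0∞} (hr : IsBalanced π.numTrans r) (x : ℕ × ℕ) (hx : r x ≠ 0) (y : ℕ × ℕ) :
    r y ≠ 0 := by
  have hdown : ∀ n i j, i + j = n → r (i, j) ≠ 0 → r (0, 0) ≠ 0 := by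
    intro n
    induction n with
    | zero =>
      intro i j hij h
      obtain ⟨rfl, rfl⟩ : i = 0 ∧ j = 0 := by omega
      exact h
    | succ n ih =>
      intro i j hij h
      have hpos : π.totI i j ≠ 0 ∨ π.totE i j ≠ 0 := by
        by_contra hcon
        push Not at hcon
        have hk : (M.k : ℝ≥0) ≠ 0 := by exact_mod_cast M.k_pos.ne'
        obtain ⟨h1, h2⟩ := hπ i j
        rw [hcon.1, hcon.2, add_zero] at h1 h2
        rcases Nat.eq_zero_or_pos j with hj | hj
        · have hi : (i : ℝ≥0) ≠ 0 := by exact_mod_cast (by omega : i ≠ 0)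
          have : 0 < min (i : ℝ≥0) (M.k : ℝ≥0) :=
            lt_min (pos_iff_ne_zero.2 hi) (pos_iff_ne_zero.2 hk)
          exact absurd h1 (not_le.2 this)
        · exact hk (h2 hj).symm
      rcases hpos with hI | hE
      · have hi : i ≠ 0 := by
          rintro rfl
          exact hI (by simp [Policy.totI])
        refine ih (i - 1) j (by omega) (hr.ne_zero_of_mem h (w := (M.muI * π.totI i j, (i - 1, j)))
          (by simp [Policy.numTrans]) (mul_ne_zero M.muI_pos.ne' hI))
      · have hj : j ≠ 0 := by
          rintro rfl
          exact hE (by simp [Policy.totE])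
        refine ih i (j - 1) (by omega) (hr.ne_zero_of_mem h (w := (M.muE * π.totE i j, (i, j - 1)))
          (by simp [Policy.numTrans]) (mul_ne_zero M.muE_pos.ne' hE))
  have h0 := hdown _ x.1 x.2 rfl hx
  obtain ⟨i, j⟩ := y
  induction i with
  | zero =>
    induction j with
    | zero => exact h0
    | succ j ih =>
      exact hr.ne_zero_of_mem ih (w := (M.lamE, (0, j + 1))) (by simp [Policy.numTrans])
        M.lamE_pos.ne'
  | succ i ih =>
    exact hr.ne_zero_of_mem ih (w := (M.lamI, (i + 1, j))) (by simp [Policy.numTrans])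
      M.lamI_pos.ne'

/-! ### Existence of the stationary distribution -/

/-- A measure that is invariant under the uniformised chain is balanced. -/
theorem isBalanced_of_unifE {S : Type} {t : S → List (ℝ≥0 × S)} {δ : ℝ≥0} (hδ0 : δ ≠ 0)
    (hδ : ∀ x, δ * outRate t x ≤ 1) {r : S → ℝ≥0∞} (hr : ∀ x, r x ≠ ⊤)
    (h : ∀ y, ∑' x, r x * unifE t δ (({y} : Set S).indicator fun _ => 1) x = r y) :
    IsBalanced t r := by
  classical
  intro y
  have h1 := h y
  have h2 : ∀ x, r x * unifE t δ (({y} : Set S).indicator fun _ => 1) x =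
      δ * (r x * rate t x y) +
        r x * (((1 - δ * outRate t x : ℝ≥0) : ℝ≥0∞) *
          ({y} : Set S).indicator (fun _ => 1) x) := by
    intro x
    have : flow t (({y} : Set S).indicator fun _ => 1) x = rate t x y := by
      rw [flow_eq_tsum_rate, tsum_eq_single y]
      · simp
      · intro z hz
        simp [hz]
    rw [unifE, this]
    ring
  simp_rw [h2] at h1
  have h3 : ∑' x, r x * (((1 - δ * outRate t x : ℝ≥0) : ℝ≥0∞) *
      ({y} : Set S).indicator (fun _ => 1) x) = ((1 - δ * outRate t y : ℝ≥0) : ℝ≥0∞) * r y := by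
    rw [tsum_eq_single y]
    · simp [mul_comm]
    · intro z hz
      simp [hz]
  rw [ENNReal.tsum_add, ENNReal.tsum_mul_left, h3] at h1
  conv_rhs at h1 => rw [← unifE_split hδ (r y) y]
  have h4 := (ENNReal.add_left_inj (ENNReal.mul_ne_top ENNReal.coe_ne_top (hr y))).1 h1
  rw [(ENNReal.mul_right_inj (by exact_mod_cast hδ0) ENNReal.coe_ne_top).1 h4, mul_comm]

namespace Policy
variable (π : Policy M)

/-- The expected time average of `f` over the first `n + 1` steps from the empty state. -/
def timeAvg (n : ℕ) : (ℕ × ℕ → ℝ) →ₗ[ℝ] ℝ :=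
  ((n : ℝ) + 1)⁻¹ • ∑ l ∈ Finset.range (n + 1),
    (LinearMap.proj (0, 0) : (ℕ × ℕ → ℝ) →ₗ[ℝ] ℝ) ∘ₗ (unif π.numTrans M.step ^ l)

theorem timeAvg_apply (n : ℕ) (f : ℕ × ℕ → ℝ) : π.timeAvg n f =
    ((n : ℝ) + 1)⁻¹ * ∑ l ∈ Finset.range (n + 1), (unif π.numTrans M.step ^ l) f (0, 0) := by
  simp [timeAvg]

theorem timeAvg_mono (n : ℕ) {f f' : ℕ × ℕ → ℝ} (h : ∀ s, f s ≤ f' s) :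
    π.timeAvg n f ≤ π.timeAvg n f' := by
  rw [timeAvg_apply, timeAvg_apply]
  gcongr with l
  exact unif_pow_mono π.step_mul_outRate_numTrans h l _

theorem timeAvg_const (n : ℕ) (c : ℝ) : π.timeAvg n (fun _ => c) = c := by
  have : (n : ℝ) + 1 ≠ 0 := by positivity
  rw [timeAvg_apply]
  simp only [unif_pow_const, Finset.sum_const, Finset.card_range, nsmul_eq_mul]
  push_cast
  field_simp

theorem timeAvg_unif (n : ℕ) (f : ℕ × ℕ → ℝ) : π.timeAvg n (unif π.numTrans M.step f) =
    π.timeAvg n f + ((n : ℝ) + 1)⁻¹ *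
      ((unif π.numTrans M.step ^ (n + 1)) f (0, 0) - f (0, 0)) := by
  have h := Finset.sum_range_sub (fun l => (unif π.numTrans M.step ^ l) f (0, 0)) (n + 1)
  simp only [pow_zero, Module.End.one_apply] at h
  rw [timeAvg_apply, timeAvg_apply, ← h, ← mul_add, ← Finset.sum_add_distrib]
  congr 1
  refine Finset.sum_congr rfl fun l _ => ?_
  rw [pow_succ, Module.End.mul_apply]
  ring

variable {π} in
/-- A nonnegative relative value function bounds the average number of jobs. -/
theorem timeAvg_jobs_le {g : ℝ} {h : ℕ × ℕ → ℝ} (hh : ∀ s, 0 ≤ h s) (h0 : h (0, 0) = 0)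
    (hg : ∀ s, h s + g = System.jobs s + unif π.numTrans M.step h s) (n : ℕ) :
    π.timeAvg n System.jobs ≤ g := by
  have h1 : System.jobs = h + (fun _ => g) - unif π.numTrans M.step h := by
    funext s
    simp only [Pi.sub_apply, Pi.add_apply]
    linarith [hg s]
  rw [h1, map_sub, map_add, timeAvg_const, timeAvg_unif, h0]
  have h2 := unif_pow_nonneg π.step_mul_outRate_numTrans hh (n + 1) (0, 0)
  have h3 : 0 ≤ ((n : ℝ) + 1)⁻¹ * ((unif π.numTrans M.step ^ (n + 1)) h (0, 0) - 0) := by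
    rw [sub_zero]
    positivity
  linarith

variable {π} in
/-- A transition changes each coordinate by at most one, so the one-step operator maps the
indicator of `y` to a function supported near `y`. -/
theorem unif_singleton_eq_zero {x y : ℕ × ℕ}
    (hx : x ∉ Finset.range (y.1 + 2) ×ˢ Finset.range (y.2 + 2)) :
    unif π.numTrans M.step (({y} : Set (ℕ × ℕ)).indicator fun _ => 1) x = 0 := by
  obtain ⟨i, j⟩ := x
  obtain ⟨i', j'⟩ := y
  simp only [Finset.mem_product, Finset.mem_range, not_and_or, not_lt] at hx
  have h : ∀ a b, (i ≤ a + 1 ∧ j ≤ b + 1) →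
      ({(i', j')} : Set (ℕ × ℕ)).indicator (fun _ => (1 : ℝ)) (a, b) = 0 := by
    intro a b hab
    refine Set.indicator_of_notMem (fun hmem => ?_) _
    rw [Set.mem_singleton_iff, Prod.mk.injEq] at hmem
    omega
  rw [unif_numTrans, h i j (by omega), h (i + 1) j (by omega), h i (j + 1) (by omega),
    h (i - 1) j (by omega), h i (j - 1) (by omega)]
  simp

variable {π} in
/-- If the time averages of the number of jobs are bounded by `g`, their limit along an ultrafilter
is a stationary distribution with mean at most `g`. No mass escapes, because the number of jobs has
finite sublevel sets. -/
theorem exists_steadyState {g : ℝ} (hg : ∀ n, π.timeAvg n System.jobs ≤ g) :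
    ∃ p : PMF (ℕ × ℕ), π.IsSteadyState p ∧ meanNumber p ≤ ENNReal.ofReal g := by
  classical
  set P := unif π.numTrans M.step with hP
  set e : ℕ × ℕ → ℕ × ℕ → ℝ := fun s => ({s} : Set (ℕ × ℕ)).indicator fun _ => 1 with he
  have he0 : ∀ s x, 0 ≤ e s x := fun s => Set.indicator_nonneg fun _ _ => zero_le_one
  have he1 : ∀ s x, e s x ≤ 1 := fun s => Set.indicator_le' (fun _ _ => le_rfl)
    fun _ _ => zero_le_one
  have hA0 : ∀ n s, 0 ≤ π.timeAvg n (e s) := fun n s => by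
    have := π.timeAvg_mono n (f := fun _ => 0) (he0 s)
    rwa [timeAvg_const] at this
  have hA1 : ∀ n s, π.timeAvg n (e s) ≤ 1 := fun n s => by
    have := π.timeAvg_mono n (f' := fun _ => 1) (he1 s)
    rwa [timeAvg_const] at this
  set U : Ultrafilter ℕ := hyperfilter ℕ with hU
  have hUtop : (U : Filter ℕ) ≤ atTop := Nat.hyperfilter_le_atTop
  have hex : ∀ s, ∃ l, Tendsto (fun n => π.timeAvg n (e s)) U (𝓝 l) := by
    intro s
    obtain ⟨l, -, hl⟩ := (isCompact_Icc (a := (0 : ℝ)) (b := 1)).ultrafilter_le_nhds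
      (U.map fun n => π.timeAvg n (e s)) (by
        rw [le_principal_iff, Ultrafilter.mem_coe, Ultrafilter.mem_map]
        exact univ_mem' fun n => ⟨hA0 n s, hA1 n s⟩)
    exact ⟨l, hl⟩
  choose q hq using hex
  have hq0 : ∀ s, 0 ≤ q s := fun s => ge_of_tendsto' (hq s) fun n => hA0 n s
  have hfin : ∀ (F : Finset (ℕ × ℕ)) (f : ℕ × ℕ → ℝ),
      Tendsto (fun n => π.timeAvg n (∑ s ∈ F, f s • e s)) U (𝓝 (∑ s ∈ F, f s * q s)) := by
    intro F f
    simp only [map_sum, map_smul, smul_eq_mul]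
    exact tendsto_finsetSum _ fun s _ => (hq s).const_mul _
  have hval : ∀ (F : Finset (ℕ × ℕ)) (f : ℕ × ℕ → ℝ) x,
      (∑ s ∈ F, f s • e s) x = if x ∈ F then f x else 0 := by
    intro F f x
    simp [he, Finset.sum_apply, Pi.single_apply]
  -- balance: the averages of `P f` and `f` differ by a vanishing boundary term
  have hbal : ∀ y, Tendsto (fun n => π.timeAvg n (P (e y))) U (𝓝 (q y)) := by
    intro y
    have h1 : Tendsto (fun n : ℕ => ((n : ℝ) + 1)⁻¹ * ((P ^ (n + 1)) (e y) (0, 0) - e y (0, 0)))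
        atTop (𝓝 0) := by
      have h2 : Tendsto (fun n : ℕ => ((n : ℝ) + 1)⁻¹) atTop (𝓝 0) :=
        (tendsto_natCast_atTop_atTop.atTop_add tendsto_const_nhds).inv_tendsto_atTop
      refine h2.zero_mul_isBoundedUnder_le (isBoundedUnder_of ⟨1, fun n => ?_⟩)
      have h3 := unif_pow_nonneg π.step_mul_outRate_numTrans (he0 y) (n + 1) (0, 0)
      have h4 := unif_pow_mono π.step_mul_outRate_numTrans (g := fun _ => 1) (he1 y) (n + 1) (0, 0)
      rw [unif_pow_const] at h4
      rw [Function.comp_apply, Real.norm_eq_abs, abs_le]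
      constructor <;> linarith [he0 y (0, 0), he1 y (0, 0)]
    have h5 := (hq y).add (h1.mono_left hUtop)
    rw [add_zero] at h5
    exact h5.congr fun n => (π.timeAvg_unif n (e y)).symm
  have hPe : ∀ y, ∑ x ∈ Finset.range (y.1 + 2) ×ˢ Finset.range (y.2 + 2),
      P (e y) x * q x = q y := by
    intro y
    refine tendsto_nhds_unique (hfin _ (P (e y))) ?_
    refine (hbal y).congr fun n => congrArg _ (funext fun x => ?_)
    rw [hval]
    split_ifs with hx
    · rfl
    · exact unif_singleton_eq_zero hx
  have hone : ∑' s, ENNReal.ofReal (q s) = 1 := by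
    apply le_antisymm
    · rw [ENNReal.tsum_eq_iSup_sum]
      refine iSup_le fun F => ?_
      rw [← ENNReal.ofReal_sum_of_nonneg fun s _ => hq0 s, ENNReal.ofReal_le_one]
      have h1 := hfin F fun _ => 1
      simp only [one_mul] at h1
      refine le_of_tendsto' h1 fun n => ?_
      refine (π.timeAvg_mono n (f' := fun _ => 1) fun x => ?_).trans_eq (π.timeAvg_const n 1)
      rw [hval F fun _ => 1]
      split_ifs <;> norm_num
    · -- no mass escapes: the box of side `K + 1` carries at least `1 - g / (K + 1)`
      have h1 : ∀ K : ℕ, ENNReal.ofReal (1 - g * ((K : ℝ) + 1)⁻¹) ≤ ∑' s, ENNReal.ofReal (q s) := by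
        intro K
        refine le_trans ?_ (ENNReal.sum_le_tsum (Finset.range (K + 1) ×ˢ Finset.range (K + 1)))
        rw [← ENNReal.ofReal_sum_of_nonneg fun s _ => hq0 s]
        refine ENNReal.ofReal_le_ofReal ?_
        have h2 := hfin (Finset.range (K + 1) ×ˢ Finset.range (K + 1)) fun _ => 1
        simp only [one_mul] at h2
        refine ge_of_tendsto' h2 fun n => ?_
        have hK : (0 : ℝ) < (K : ℝ) + 1 := by positivity
        -- Markov's inequality
        have h3 := π.timeAvg_mono n (f := (fun _ => 1) - ((K : ℝ) + 1)⁻¹ • System.jobs)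
          (f' := ∑ s ∈ Finset.range (K + 1) ×ˢ Finset.range (K + 1), (1 : ℝ) • e s) fun x => by
            rw [hval _ fun _ => 1]
            simp only [Pi.sub_apply, Pi.smul_apply, smul_eq_mul]
            split_ifs with hx
            · have := mul_nonneg (inv_pos.2 hK).le (System.jobs_nonneg x)
              linarith
            · have hx' : (K : ℝ) + 1 ≤ System.jobs x := by
                simp only [Finset.mem_product, Finset.mem_range, not_and_or, not_lt] at hx
                rw [System.jobs]
                exact_mod_cast (by omega : K + 1 ≤ x.1 + x.2)
              have := mul_le_mul_of_nonneg_left hx' (inv_pos.2 hK).le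
              rw [inv_mul_cancel₀ hK.ne'] at this
              linarith
        rw [map_sub, timeAvg_const, map_smul, smul_eq_mul] at h3
        refine le_trans ?_ h3
        have := mul_le_mul_of_nonneg_left (hg n) (inv_pos.2 hK).le
        linarith
      have h2 : Tendsto (fun K : ℕ => ENNReal.ofReal (1 - g * ((K : ℝ) + 1)⁻¹)) atTop (𝓝 1) := by
        have h3 : Tendsto (fun n : ℕ => ((n : ℝ) + 1)⁻¹) atTop (𝓝 0) :=
          (tendsto_natCast_atTop_atTop.atTop_add tendsto_const_nhds).inv_tendsto_atTop
        have h4 := ENNReal.tendsto_ofReal ((h3.const_mul g).const_sub 1)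
        simpa using h4
      exact le_of_tendsto' h2 h1
  refine ⟨⟨fun s => ENNReal.ofReal (q s), hone ▸ ENNReal.summable.hasSum⟩, ?_, ?_⟩
  · refine isBalanced_of_unifE M.step_pos.ne' π.step_mul_outRate_numTrans
      (fun x => ENNReal.ofReal_ne_top) fun y => ?_
    change ∑' x, ENNReal.ofReal (q x) * _ = ENNReal.ofReal (q y)
    have hPe0 := unif_nonneg π.step_mul_outRate_numTrans (he0 y)
    have h1 : ∀ x, unifE π.numTrans M.step (({y} : Set (ℕ × ℕ)).indicator fun _ => 1) x =
        ENNReal.ofReal (P (e y) x) := by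
      intro x
      rw [ofReal_unif π.step_mul_outRate_numTrans (he0 y)]
      congr 1
      funext z
      by_cases hz : z = y <;> simp [he, hz]
    simp_rw [h1]
    rw [tsum_eq_sum (s := Finset.range (y.1 + 2) ×ˢ Finset.range (y.2 + 2)), ← hPe y,
      ENNReal.ofReal_sum_of_nonneg fun x _ => mul_nonneg (hPe0 x) (hq0 x)]
    · exact Finset.sum_congr rfl fun x _ => by rw [ENNReal.ofReal_mul (hPe0 x), mul_comm]
    · intro x hx
      rw [unif_singleton_eq_zero hx]
      simp
  · unfold meanNumber
    rw [ENNReal.tsum_eq_iSup_sum]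
    refine iSup_le fun F => ?_
    change ∑ s ∈ F, ENNReal.ofReal (q s) * _ ≤ _
    have h1 : ∀ s : ℕ × ℕ, ENNReal.ofReal (q s) * ((s.1 : ℝ≥0∞) + s.2) =
        ENNReal.ofReal (System.jobs s * q s) := by
      intro s
      rw [ENNReal.ofReal_mul (System.jobs_nonneg s), System.jobs,
        ENNReal.ofReal_add (by positivity) (by positivity), ENNReal.ofReal_natCast,
        ENNReal.ofReal_natCast, mul_comm]
    simp_rw [h1]
    rw [← ENNReal.ofReal_sum_of_nonneg fun s _ => mul_nonneg (System.jobs_nonneg s) (hq0 s)]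
    refine ENNReal.ofReal_le_ofReal (le_of_tendsto' (hfin F System.jobs) fun n => ?_)
    refine (π.timeAvg_mono n fun x => ?_).trans (hg n)
    rw [hval]
    split_ifs
    · exact le_rfl
    · exact System.jobs_nonneg x

end Policy

end ElasticQueue

end

open ElasticQueue
theorem mainTheorem8 (M : System) (hload : M.load < 1) :
    ∃ π ∈ classP M, ∃ p : PMF (ℕ × ℕ),
      π.IsSteadyState p ∧ (∀ q : PMF (ℕ × ℕ), π.IsSteadyState q → q = p) ∧
      meanNumber p < ⊤ ∧ π.meanResponseTime p < ⊤ ∧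
      ∀ (π' : Policy M) (p' : PMF (ℕ × ℕ)), π'.IsSteadyState p' →
        meanNumber p ≤ meanNumber p' ∧ π.meanResponseTime p ≤ π'.meanResponseTime p' := by
  obtain ⟨g, h, hmono, h0, hfix, hg⟩ := System.exists_averageCost hload
  choose act hact using fun s => M.exists_bellman_eq h s
  have hfix' : ∀ s, h s + g = System.jobs s + unif (greedy M act).numTrans M.step h s := fun s => by
    rw [unif_greedy, ← hact s, hfix s]
  have hh : ∀ s, 0 ≤ h s := fun s => h0 ▸ hmono.zero_le s
  obtain ⟨p, hp, hpg⟩ := Policy.exists_steadyState (Policy.timeAvg_jobs_le hh h0 hfix')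
  have hlower : ∀ (π' : Policy M) (p' : PMF (ℕ × ℕ)), π'.IsSteadyState p' →
      ENNReal.ofReal g ≤ ((M.lamI + M.lamE : NNReal) : ENNReal) * π'.meanResponseTime p' :=
    fun π' p' hp' => Policy.ofReal_le_lam_mul_meanResponseTime hg hp'
  have hlam : ((M.lamI + M.lamE : NNReal) : ENNReal) ≠ 0 := by
    have := M.lamI_pos
    exact_mod_cast (by positivity : M.lamI + M.lamE ≠ 0)
  have hupper := (Policy.lam_mul_meanResponseTime_le hp).trans hpg
  refine ⟨greedy M act, greedy_mem_classP act, p, hp, fun q hq => ?_,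
    hpg.trans_lt ENNReal.ofReal_lt_top, ?_, fun π' p' hp' => ⟨?_, ?_⟩⟩
  · refine stationary_unique (c := M.step⁻¹) (fun s => ?_)
      (fun r hr x hx y => (greedy_mem_classP act).1.irreducible hr x hx y) hq hp
    rw [← one_div, le_div_iff₀' M.step_pos]
    exact (greedy M act).step_mul_outRate_numTrans s
  · refine lt_of_not_ge fun htop => ?_
    rw [top_le_iff.1 htop, ENNReal.mul_top hlam] at hupper
    exact absurd (top_le_iff.1 hupper) ENNReal.ofReal_ne_top
  · exact hpg.trans ((hlower π' p' hp').trans (Policy.lam_mul_meanResponseTime_le hp'))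
  · exact (ENNReal.mul_le_mul_iff_right hlam ENNReal.coe_ne_top).1
      (hupper.trans (hlower π' p' hp'))
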